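/- Conventions. For a pointed path-connected topological space $(X,b)$: * $C_*=C_*(X,b;\mathbb Q)$ is the dg coalgebra of normalized singular chains generated by the singular simplices $\sigma:\Delta^n\to X$ all of whose vertices are sent to $b$, modulo degenerate simplices, with the Alexander–Whitney coproduct $\Delta$; $\bar C_*=C_{*\ge 1}$. * $\Omega C_*$ is its cobar construction: the tensor algebra $T(s^{-1}\bar C_*)$ with the derivation $D$ extending $-s^{-1}\partial s+(s^{-1}\otimes s^{-1})\Delta s$ ($\Delta$ reduced). Write $[\sigma]$ for the generator of degree $n-1$ given by a pointed $n$-simplex, $n\ge1$. Put $\langle\sigma\rangle=[\sigma]$ for $n\ge 2$, $\langle\sigma\rangle=1+[\sigma]$ for $n=1$ and $\langle\sigma\rangle=1$ for $n=0$. * $\nabla:\Omega C_*\to\Omega C_*\otimes\Omega C_*$ is the algebra map (to the graded tensor product) induced by the Serre diagonal of cubes: for a pointed $n$-simplex $\sigma$, $n\ge1$, $\nabla\langle\sigma\rangle=\sum_{0=b_0<b_1<\dots<b_k=n}(-1)^{\sum_{j<k}(b_j-j)}\,\langle\sigma|_{\{b_0,\dots,b_k\}}\rangle\otimes\langle\sigma|_{\{b_0,\dots,b_1\}}\rangle\langle\sigma|_{\{b_1,\dots,b_2\}}\rangle\cdots\langle\sigma|_{\{b_{k-1},\dots,b_k\}}\rangle$,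 where $\{b_{j-1},\dots,b_j\}$ stands for all consecutive vertices from $b_{j-1}$ to $b_j$. Together with the projection onto tensors of length zero, it induces a bialgebra structure on $H_0(\Omega C_*(X,b;\mathbb Q))$. * $\Omega_bX$ is the topological monoid of Moore loops in $X$ at $b$, and $C^\square_*(\Omega_bX;\mathbb Q)$ the dg algebra of normalized singular cubical chains on it. In $\pi_1(X,b)$ the product is concatenation: first the first factor, then the second. * $\theta:\Omega C_*(X,b;\mathbb Q)\to C^\square_*(\Omega_bX;\mathbb Q)$ is Adams' map. In degree $0$ it is given, up to boundaries, by $[\sigma]\mapsto\gamma_\sigma-1$ for a pointed $1$-simplex $\sigma$, where $\gamma_\sigma$ is the Moore loop of length $1$ which runs along $\sigma$ from its vertex $0$ to its vertex $1$. Thus $H_0(\theta)$ is the algebra map sending the class of $1+[\sigma]$ to the class of $\gamma_\sigma$. Theorem. For all pointed path-connected spaces $(X,b)$: 1. The algebra map $H_0(\theta):H_0(\Omega C_*(X,b;\mathbb Q))\to H_0(\Omega_bX;\mathbb Q)$ is an isomorphism, and it is the map induced on $H_0$ by every morphism of dg algebras $\Omega C_*(X,b;\mathbb Q)\to C^\square_*(\Omega_bX;\mathbb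 Q)$ which, up to boundaries, sends $[\sigma]$ to $\gamma_\sigma-1$ for all pointed $1$-simplices $\sigma$. There is an algebra isomorphism $\kappa:H_0(\Omega_bX;\mathbb Q)\cong\mathbb Q[\pi_1(X,b)]$ sending the class of a Moore loop to its class in $\pi_1(X,b)$, and the composite $\Phi=\kappa\circ H_0(\theta):H_0(\Omega C_*(X,b;\mathbb Q))\to\mathbb Q[\pi_1(X,b)]$ is an isomorphism of bialgebras. 2. The bialgebra $H_0(\Omega C_*(X,b;\mathbb Q))$ has an antipode, which makes it a Hopf algebra. 3. There is an isomorphism $e$ from $\pi_1(X,b)$ to the group of group-like elements of $H_0(\Omega C_*(X,b;\mathbb Q))$, with $\Phi(e(g))=g$ for all $g\in\pi_1(X,b)$. 4. All of this is functorial: a pointed continuous map $f:(X,b)\to(Y,c)$ of path-connected spaces induces a bialgebra map $f_*:H_0(\Omega C_*(X,b;\mathbb Q))\to H_0(\Omega C_*(Y,c;\mathbb Q))$, with $\mathrm{id}_*=\mathrm{id}$ and $(g\circ f)_*=g_*\circ f_*$, and $\Phi\circ f_*=\mathbb Q[\pi_1(f)]\circ\Phi$ and $e\circ\pi_1(f)=f_*\circ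 e$. -/

import Mathlib

open scoped TensorProduct DirectSum NNReal

universe u

namespace LoopCobar

noncomputable section

section Chains

variable {X : Type u} [TopologicalSpace X] {b : X}

/-- Singular `n`-simplices of `X` all of whose vertices are sent to the base point `b`. -/
def PSimplex (X : Type u) [TopologicalSpace X] (b : X) (n : ℕ) : Type u :=
  {σ : C(stdSimplex ℝ (Fin (n + 1)), X) // ∀ i, σ (stdSimplex.vertex i) = b}

/-- Precomposition of a pointed simplex with the affine map induced by a map of vertices. -/
def PSimplex.pull {m n : ℕ} (f : Fin (m + 1) → Fin (n + 1)) (σ : PSimplex X b n) :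
    PSimplex X b m :=
  ⟨σ.1.comp ⟨stdSimplex.map f, stdSimplex.continuous_map f⟩, fun i => by
    simp only [ContinuousMap.comp_apply, ContinuousMap.coe_mk, stdSimplex.map_vertex]
    exact σ.2 _⟩

lemma PSimplex.pull_pull {l m n : ℕ} (g : Fin (l + 1) → Fin (m + 1))
    (f : Fin (m + 1) → Fin (n + 1)) (σ : PSimplex X b n) :
    (σ.pull f).pull g = σ.pull (f ∘ g) := by
  apply Subtype.ext
  ext x
  simp only [PSimplex.pull, ContinuousMap.comp_apply, ContinuousMap.coe_mk]
  rw [stdSimplex.map_comp_apply]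

lemma PSimplex.pull_id {n : ℕ} (σ : PSimplex X b n) : σ.pull id = σ := by
  apply Subtype.ext
  ext x
  simp [PSimplex.pull]

/-- The `i`-th face. -/
def PSimplex.face {n : ℕ} (i : Fin (n + 2)) (σ : PSimplex X b (n + 1)) : PSimplex X b n :=
  σ.pull i.succAbove

/-- The `j`-th degeneracy. -/
def PSimplex.degen {n : ℕ} (j : Fin (n + 1)) (σ : PSimplex X b n) : PSimplex X b (n + 1) :=
  σ.pull j.predAbove

/-- Degenerate simplices: those in the image of some degeneracy. -/
def PSimplex.IsDegenerate : {n : ℕ} → PSimplex X b n → Prop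
  | 0, _ => False
  | n + 1, σ => ∃ (j : Fin (n + 1)) (τ : PSimplex X b n), σ = τ.degen j

/-- The front `p`-face, spanned by the vertices `0, …, p`. -/
def PSimplex.front {n p q : ℕ} (h : p + q = n) (σ : PSimplex X b n) : PSimplex X b p :=
  σ.pull fun i => ⟨i, by omega⟩

/-- The back `q`-face, spanned by the vertices `n - q, …, n`. -/
def PSimplex.back {n p q : ℕ} (h : p + q = n) (σ : PSimplex X b n) : PSimplex X b q :=
  σ.pull fun i => ⟨p + i, by omega⟩

lemma succAbove_predAbove_eq {n : ℕ} (j : Fin (n + 1)) (k : Fin (n + 2)) :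
    j.castSucc.succAbove (j.predAbove k) = if k = j.castSucc then j.succ else k := by
  split_ifs with h
  · subst h; simp
  · exact Fin.succAbove_predAbove h

lemma PSimplex.isDegenerate_of_pull {n m : ℕ} (σ : PSimplex X b n)
    (g : Fin (m + 2) → Fin (n + 1)) (i : Fin (m + 1)) (hi : g i.castSucc = g i.succ) :
    (σ.pull g).IsDegenerate := by
  refine ⟨i, (σ.pull g).face i.castSucc, ?_⟩
  rw [PSimplex.face, PSimplex.degen, PSimplex.pull_pull, PSimplex.pull_pull]
  congr 1
  funext k
  simp only [Function.comp, succAbove_predAbove_eq]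
  split_ifs with h
  · subst h; exact hi
  · rfl

lemma PSimplex.isDegenerate_degen_pull {n m : ℕ} (τ : PSimplex X b n) (j : Fin (n + 1))
    (f : Fin (m + 2) → Fin (n + 2)) (i : Fin (m + 1))
    (h₀ : f i.castSucc = j.castSucc) (h₁ : f i.succ = j.succ) :
    ((τ.degen j).pull f).IsDegenerate := by
  rw [PSimplex.degen, PSimplex.pull_pull]
  exact PSimplex.isDegenerate_of_pull _ _ i (by simp [h₀, h₁])

variable (X b) in
/-- The span of the degenerate simplices. -/
def degenerateChains (n : ℕ) : Submodule ℚ (PSimplex X b n →₀ ℚ) :=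
  Submodule.span ℚ ((fun σ => Finsupp.single σ (1 : ℚ)) '' {σ | σ.IsDegenerate})

variable (X b) in
/-- Pointed normalized singular chains in degree `n`: the rational vector space on the pointed
`n`-simplices, modulo the degenerate ones. -/
def NChain (n : ℕ) : Type u := (PSimplex X b n →₀ ℚ) ⧸ degenerateChains X b n

instance (n : ℕ) : AddCommGroup (NChain X b n) :=
  inferInstanceAs (AddCommGroup ((PSimplex X b n →₀ ℚ) ⧸ degenerateChains X b n))

instance (n : ℕ) : Module ℚ (NChain X b n) :=
  inferInstanceAs (Module ℚ ((PSimplex X b n →₀ ℚ) ⧸ degenerateChains X b n))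

/-- The class of a pointed simplex. -/
def NChain.of {n : ℕ} (σ : PSimplex X b n) : NChain X b n :=
  (degenerateChains X b n).mkQ (Finsupp.single σ 1)

lemma NChain.of_eq_zero {n : ℕ} {σ : PSimplex X b n} (h : σ.IsDegenerate) :
    NChain.of σ = 0 :=
  (Submodule.Quotient.mk_eq_zero _).2 (Submodule.subset_span ⟨σ, h, rfl⟩)

/-- Linear extension of a function on simplices which vanishes on degenerate ones. -/
def NChain.lift {n : ℕ} {W : Type*} [AddCommGroup W] [Module ℚ W] (f : PSimplex X b n → W)
    (hf : ∀ σ, σ.IsDegenerate → f σ = 0) : NChain X b n →ₗ[ℚ] W :=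
  (degenerateChains X b n).liftQ (Finsupp.linearCombination ℚ f) <| by
    rw [degenerateChains, Submodule.span_le]
    rintro _ ⟨σ, h, rfl⟩
    simpa using hf σ h

@[simp] lemma NChain.lift_of {n : ℕ} {W : Type*} [AddCommGroup W] [Module ℚ W]
    (f : PSimplex X b n → W) (hf : ∀ σ, σ.IsDegenerate → f σ = 0) (σ : PSimplex X b n) :
    NChain.lift f hf (NChain.of σ) = f σ := by
  refine ((degenerateChains X b n).liftQ_apply _ _).trans ?_
  simp

lemma NChain.hom_ext {n : ℕ} {W : Type*} [AddCommGroup W] [Module ℚ W]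
    {f g : NChain X b n →ₗ[ℚ] W} (h : ∀ σ, f (NChain.of σ) = g (NChain.of σ)) : f = g := by
  apply Submodule.linearMap_qext (degenerateChains X b n)
  refine Finsupp.lhom_ext' fun σ => LinearMap.ext_ring ?_
  exact h σ

/-- The boundary operator `∂ = ∑ (-1)^i d_i`. -/
def NChain.bd (n : ℕ) : NChain X b (n + 1) →ₗ[ℚ] NChain X b n :=
  NChain.lift (fun σ => ∑ i : Fin (n + 2), (-1 : ℚ) ^ (i : ℕ) • NChain.of (σ.face i)) <| by
    rintro _ ⟨j, τ, rfl⟩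
    have key : ∀ i : Fin (n + 2), i ≠ j.castSucc → i ≠ j.succ →
        NChain.of ((τ.degen j).face i) = 0 := by
      intro i h₀ h₁
      apply NChain.of_eq_zero
      rcases n with _ | n
      · exfalso
        simp only [ne_eq, Fin.ext_iff, Fin.val_castSucc, Fin.val_succ] at h₀ h₁
        omega
      · simp only [ne_eq, Fin.ext_iff, Fin.val_castSucc, Fin.val_succ] at h₀ h₁
        rcases Nat.lt_or_ge (i : ℕ) j with hij | hij
        · refine PSimplex.isDegenerate_degen_pull _ _ _ ⟨j - 1, by omega⟩ ?_ ?_ <;>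
          · simp only [Fin.ext_iff, Fin.succAbove, Fin.lt_def, Fin.val_castSucc]
            split_ifs <;> simp at * <;> omega
        · refine PSimplex.isDegenerate_degen_pull _ _ _ ⟨j, by omega⟩ ?_ ?_ <;>
          · simp only [Fin.ext_iff, Fin.succAbove, Fin.lt_def, Fin.val_castSucc]
            split_ifs <;> simp at * <;> omega
    have e₀ : (τ.degen j).face j.castSucc = τ := by
      rw [PSimplex.face, PSimplex.degen, PSimplex.pull_pull]
      convert PSimplex.pull_id τ
      funext k; simp
    have e₁ : (τ.degen j).face j.succ = τ := by
      rw [PSimplex.face, PSimplex.degen, PSimplex.pull_pull]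
      convert PSimplex.pull_id τ
      funext k
      rcases lt_or_ge k.castSucc j.succ with h | h
      · rw [Function.comp, Fin.succAbove_of_castSucc_lt _ _ h, Fin.predAbove_of_le_castSucc]
        · simp
        · exact Fin.le_castSucc_iff.2 h
      · rw [Function.comp, Fin.succAbove_of_le_castSucc _ _ h, Fin.predAbove_of_castSucc_lt]
        · simp
        · exact lt_of_lt_of_le (Fin.castSucc_lt_succ) (h.trans Fin.castSucc_lt_succ.le)
    rw [Finset.sum_eq_add (j.castSucc) (j.succ) (by simp [Fin.ext_iff])
      (fun i _ h => by rw [key i h.1 h.2, smul_zero]) (by simp) (by simp), e₀, e₁]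
    simp [pow_succ]

/-- The component `C_n → C_p ⊗ C_q` (`p + q = n`) of the Alexander-Whitney coproduct. -/
def NChain.aw {n p q : ℕ} (h : p + q = n) :
    NChain X b n →ₗ[ℚ] NChain X b p ⊗[ℚ] NChain X b q :=
  NChain.lift (fun σ => NChain.of (σ.front h) ⊗ₜ[ℚ] NChain.of (σ.back h)) <| by
    intro σ hσ
    rcases n with _ | n
    · exact hσ.elim
    obtain ⟨j, τ, rfl⟩ := hσ
    rcases Nat.lt_or_ge (j : ℕ) p with hj | hj
    · obtain ⟨p, rfl⟩ : ∃ p', p = p' + 1 := ⟨p - 1, by omega⟩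
      rw [NChain.of_eq_zero (σ := PSimplex.front h _), TensorProduct.zero_tmul]
      exact PSimplex.isDegenerate_degen_pull _ _ _ ⟨j, by omega⟩ (by simp [Fin.ext_iff])
        (by simp [Fin.ext_iff])
    · obtain ⟨q, rfl⟩ : ∃ q', q = q' + 1 := ⟨q - 1, by omega⟩
      rw [NChain.of_eq_zero (σ := PSimplex.back h _), TensorProduct.tmul_zero]
      exact PSimplex.isDegenerate_degen_pull _ _ _ ⟨j - p, by omega⟩
        (by simp [Fin.ext_iff]; omega) (by simp [Fin.ext_iff]; omega)

end Chains

section DGAlgebra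

variable {A B : Type*} [Ring A] [Algebra ℚ A] [Ring B] [Algebra ℚ B]

/-- `(A, 𝒜, d)` is a differential graded algebra (non-negatively graded, with `d` of degree
`-1`). -/
class IsDGAlgebra (𝒜 : ℕ → Submodule ℚ A) [GradedAlgebra 𝒜] (d : A →ₗ[ℚ] A) : Prop where
  d_mem : ∀ {n : ℕ} {a : A}, a ∈ 𝒜 (n + 1) → d a ∈ 𝒜 n
  d_zero : ∀ {a : A}, a ∈ 𝒜 0 → d a = 0
  leibniz : ∀ {n : ℕ} {a : A} (c : A), a ∈ 𝒜 n → d (a * c) = d a * c + (-1 : ℚ) ^ n • (a * d c)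
  d_d : ∀ a : A, d (d a) = 0

variable (𝒜 : ℕ → Submodule ℚ A) [GradedAlgebra 𝒜] (d : A →ₗ[ℚ] A) [IsDGAlgebra 𝒜 d]
variable (ℬ : ℕ → Submodule ℚ B) [GradedAlgebra ℬ] (d' : B →ₗ[ℚ] B) [IsDGAlgebra ℬ d']

/-- Cycles of degree zero. -/
def cycles₀ : Subalgebra ℚ A where
  carrier := {a | a ∈ 𝒜 0 ∧ d a = 0}
  mul_mem' {a c} ha hc := ⟨by simpa using SetLike.mul_mem_graded ha.1 hc.1,
    by rw [IsDGAlgebra.leibniz (𝒜 := 𝒜) c ha.1, ha.2, hc.2]; simp⟩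
  add_mem' {a c} ha hc := ⟨add_mem ha.1 hc.1, by rw [map_add, ha.2, hc.2, add_zero]⟩
  algebraMap_mem' r := ⟨SetLike.algebraMap_mem_graded 𝒜 r,
    IsDGAlgebra.d_zero (𝒜 := 𝒜) (SetLike.algebraMap_mem_graded 𝒜 r)⟩

/-- Boundaries of degree zero, an ideal of the algebra of cycles of degree zero. -/
def boundaries₀ : Ideal (cycles₀ 𝒜 d) where
  carrier := {a | ∃ c ∈ 𝒜 1, d c = a}
  add_mem' := by
    rintro _ _ ⟨c, hc, h⟩ ⟨c', hc', h'⟩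
    exact ⟨c + c', add_mem hc hc', by rw [map_add, h, h']; rfl⟩
  zero_mem' := ⟨0, zero_mem _, by simp⟩
  smul_mem' := by
    rintro a _ ⟨c, hc, h⟩
    refine ⟨a * c, by simpa using SetLike.mul_mem_graded a.2.1 hc, ?_⟩
    rw [IsDGAlgebra.leibniz (𝒜 := 𝒜) c a.2.1, a.2.2, h]
    simp

instance : (boundaries₀ 𝒜 d).IsTwoSided where
  mul_mem_of_left := by
    rintro _ a ⟨c, hc, h⟩
    refine ⟨c * a, by simpa using SetLike.mul_mem_graded hc a.2.1, ?_⟩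
    rw [IsDGAlgebra.leibniz (𝒜 := 𝒜) (a : A) hc, a.2.2, h]
    simp

/-- The zeroth homology algebra `H₀ = Z₀ / B₀` of a differential graded algebra. -/
def H0 : Type _ := cycles₀ 𝒜 d ⧸ boundaries₀ 𝒜 d

instance : Ring (H0 𝒜 d) := inferInstanceAs (Ring (cycles₀ 𝒜 d ⧸ boundaries₀ 𝒜 d))
instance : Algebra ℚ (H0 𝒜 d) := inferInstanceAs (Algebra ℚ (cycles₀ 𝒜 d ⧸ boundaries₀ 𝒜 d))

/-- The homology class of a cycle of degree zero. -/
def H0.mk : cycles₀ 𝒜 d →ₐ[ℚ] H0 𝒜 d := Ideal.Quotient.mkₐ ℚ (boundaries₀ 𝒜 d)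

lemma H0.mk_surjective : Function.Surjective (H0.mk 𝒜 d) :=
  Ideal.Quotient.mkₐ_surjective ℚ (boundaries₀ 𝒜 d)

variable {𝒜 d} in
lemma H0.mk_eq_zero {z : cycles₀ 𝒜 d} : H0.mk 𝒜 d z = 0 ↔ ∃ c ∈ 𝒜 1, d c = z :=
  Ideal.Quotient.eq_zero_iff_mem

variable {𝒜 d} in
/-- Algebra maps out of `H₀`. -/
def H0.lift {W : Type*} [Semiring W] [Algebra ℚ W] (f : cycles₀ 𝒜 d →ₐ[ℚ] W)
    (hf : ∀ z : cycles₀ 𝒜 d, ∀ c ∈ 𝒜 1, d c = z → f z = 0) : H0 𝒜 d →ₐ[ℚ] W :=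
  Ideal.Quotient.liftₐ (boundaries₀ 𝒜 d) f (fun z ⟨c, hc, h⟩ => hf z c hc h)

@[simp] lemma H0.lift_mk {W : Type*} [Semiring W] [Algebra ℚ W] (f : cycles₀ 𝒜 d →ₐ[ℚ] W)
    (hf : ∀ z : cycles₀ 𝒜 d, ∀ c ∈ 𝒜 1, d c = z → f z = 0) (z : cycles₀ 𝒜 d) :
    H0.lift f hf (H0.mk 𝒜 d z) = f z := rfl

/-- Every element of degree zero is a cycle. -/
def cycle (a : A) (ha : a ∈ 𝒜 0) : cycles₀ 𝒜 d := ⟨a, ha, IsDGAlgebra.d_zero (𝒜 := 𝒜) ha⟩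

/-- A morphism of differential graded algebras. -/
structure IsDGHom (f : A →ₐ[ℚ] B) : Prop where
  map_mem : ∀ {n : ℕ} {a : A}, a ∈ 𝒜 n → f a ∈ ℬ n
  map_d : ∀ a : A, f (d a) = d' (f a)

variable {𝒜 d ℬ d'} in
/-- The map induced on cycles of degree zero. -/
def IsDGHom.cyclesMap {f : A →ₐ[ℚ] B} (hf : IsDGHom 𝒜 d ℬ d' f) :
    cycles₀ 𝒜 d →ₐ[ℚ] cycles₀ ℬ d' :=
  (f.comp (cycles₀ 𝒜 d).val).codRestrict _ fun z =>
    ⟨hf.map_mem z.2.1, by simpa [z.2.2] using (hf.map_d (z : A)).symm⟩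

variable {𝒜 d ℬ d'} in
/-- The algebra map induced on `H₀` by a morphism of differential graded algebras. -/
def IsDGHom.H0map {f : A →ₐ[ℚ] B} (hf : IsDGHom 𝒜 d ℬ d' f) : H0 𝒜 d →ₐ[ℚ] H0 ℬ d' :=
  H0.lift ((H0.mk ℬ d').comp hf.cyclesMap) fun z c hc h =>
    H0.mk_eq_zero.2 ⟨f c, hf.map_mem hc, by rw [← hf.map_d, h]; rfl⟩

end DGAlgebra

section TensorAlg

variable (M : ℕ → Type u) [∀ n, AddCommGroup (M n)] [∀ n, Module ℚ (M n)]

/-- The tensor algebra of a non-negatively graded vector space `⨁ M n`. -/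
abbrev TA : Type u := TensorAlgebra ℚ (⨁ n, M n)

namespace TA

variable {M} in
/-- The inclusion of the generators of degree `n`. -/
def gen (n : ℕ) : M n →ₗ[ℚ] TA M :=
  TensorAlgebra.ι ℚ ∘ₗ DirectSum.lof ℚ ℕ M n

/-- The elements of total degree `m`: linear combinations of products of generators whose degrees
add up to `m`. -/
def gr (m : ℕ) : Submodule ℚ (TA M) :=
  Submodule.span ℚ {x | ∃ l : List (Σ n, M n),
    (l.map Sigma.fst).sum = m ∧ (l.map fun p => gen p.1 p.2).prod = x}

variable {M}

lemma gen_mem {n : ℕ} (x : M n) : gen n x ∈ gr M n :=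
  Submodule.subset_span ⟨[⟨n, x⟩], by simp, by simp⟩

instance : SetLike.GradedMonoid (gr M) where
  one_mem := Submodule.subset_span ⟨[], by simp, by simp⟩
  mul_mem := by
    intro i j x y hx hy
    have : x * y ∈ gr M i * gr M j := Submodule.mul_mem_mul hx hy
    rw [gr, gr, Submodule.span_mul_span] at this
    refine Submodule.span_mono ?_ this
    rintro _ ⟨_, ⟨l, hl, rfl⟩, _, ⟨l', hl', rfl⟩, rfl⟩
    exact ⟨l ++ l', by simp [hl, hl'], by simp⟩

lemma hom_ext {W : Type*} [Semiring W] [Algebra ℚ W] {f g : TA M →ₐ[ℚ] W}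
    (h : ∀ n (x : M n), f (gen n x) = g (gen n x)) : f = g := by
  refine TensorAlgebra.hom_ext (DirectSum.linearMap_ext _ fun n => LinearMap.ext fun x => ?_)
  exact h n x

/-- The algebra map out of the tensor algebra with given values on generators. -/
def lift {W : Type*} [Semiring W] [Algebra ℚ W] (f : ∀ n, M n →ₗ[ℚ] W) : TA M →ₐ[ℚ] W :=
  TensorAlgebra.lift ℚ (DirectSum.toModule ℚ ℕ W f)

@[simp] lemma lift_gen {W : Type*} [Semiring W] [Algebra ℚ W] (f : ∀ n, M n →ₗ[ℚ] W) (n : ℕ)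
    (x : M n) : lift f (gen n x) = f n x := by
  simp [lift, gen]

instance : GradedAlgebra (gr M) :=
  GradedAlgebra.ofAlgHom (gr M)
    (lift fun n => DirectSum.lof ℚ ℕ (fun i => gr M i) n ∘ₗ
      (gen n).codRestrict (gr M n) gen_mem)
    (hom_ext fun n x => by
      simp only [AlgHom.comp_apply, lift_gen, LinearMap.comp_apply, DirectSum.lof_eq_of,
        DirectSum.coeAlgHom_of]
      rfl)
    (by
      rintro i ⟨x, hx⟩
      induction hx using Submodule.span_induction with
      | zero => simp only [map_zero]; exact (map_zero (DirectSum.of (fun i => gr M i) i)).symm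
      | add x y hx hy ihx ihy =>
        simp only [map_add, ihx, ihy]
        exact (map_add (DirectSum.of (fun i => gr M i) i) _ _).symm
      | smul r x hx ih =>
        simp only [map_smul, ih]
        exact (map_smul (DirectSum.lof ℚ ℕ (fun i => gr M i) i) _ _).symm
      | mem x hx =>
        obtain ⟨l, rfl, rfl⟩ := hx
        induction l with
        | nil => simp; rfl
        | cons p l ih =>
          simp only [List.map_cons, List.prod_cons, map_mul]
          rw [ih, lift_gen, LinearMap.comp_apply,
            DirectSum.lof_eq_of, DirectSum.of_mul_of]
          rfl)

/-- The parity involution `x ↦ (-1)^|x| x`. -/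
def parity : TA M →ₐ[ℚ] TA M := lift fun n => (-1 : ℚ) ^ n • gen n

lemma parity_of_mem {n : ℕ} {x : TA M} (hx : x ∈ gr M n) : parity x = (-1 : ℚ) ^ n • x := by
  induction hx using Submodule.span_induction with
  | zero => simp
  | add x y hx hy ihx ihy => rw [map_add, ihx, ihy, smul_add]
  | smul r x hx ih => rw [map_smul, ih, smul_comm]
  | mem x hx =>
    obtain ⟨l, rfl, rfl⟩ := hx
    induction l with
    | nil => simp
    | cons p l ih =>
      simp only [List.map_cons, List.prod_cons, List.sum_cons, map_mul, ih]
      rw [parity, lift_gen, LinearMap.smul_apply, smul_mul_smul_comm, ← pow_add]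

/-- Auxiliary: `x ↦ [[(-1)^|x| x, δ x], [0, x]]`; algebra maps of this form are the same as graded
derivations. -/
def derivMat (δ : ∀ n, M n →ₗ[ℚ] TA M) : TA M →ₐ[ℚ] Matrix (Fin 2) (Fin 2) (TA M) :=
  lift fun n =>
    { toFun := fun x => !![(-1 : ℚ) ^ n • gen n x, δ n x; 0, gen n x]
      map_add' := fun x y => by ext i j; fin_cases i <;> fin_cases j <;> simp
      map_smul' := fun r x => by
        ext i j; fin_cases i <;> fin_cases j <;> simp [smul_comm r] }

/-- The unique graded derivation extending `δ` on generators. -/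
def deriv (δ : ∀ n, M n →ₗ[ℚ] TA M) : TA M →ₗ[ℚ] TA M where
  toFun x := derivMat δ x 0 1
  map_add' x y := by simp
  map_smul' r x := by simp

@[simp] lemma deriv_gen (δ : ∀ n, M n →ₗ[ℚ] TA M) (n : ℕ) (x : M n) :
    deriv δ (gen n x) = δ n x := by
  simp [deriv, derivMat]

lemma derivMat_apply (δ : ∀ n, M n →ₗ[ℚ] TA M) (x : TA M) :
    derivMat δ x = !![parity x, deriv δ x; 0, x] := by
  have h : ∀ x, derivMat δ x 0 0 = parity x ∧ derivMat δ x 1 0 = 0 ∧ derivMat δ x 1 1 = x := by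
    intro x
    induction x using TensorAlgebra.induction with
    | algebraMap r => simp [Matrix.algebraMap_matrix_apply]
    | ι v =>
      induction v using DirectSum.induction_on with
      | zero => simp
      | of n x =>
        have : TensorAlgebra.ι ℚ (DirectSum.of M n x) = gen n x := rfl
        rw [this]
        simp [derivMat, parity]
      | add x y hx hy => simp [hx, hy]
    | mul x y hx hy => simp [Matrix.mul_apply, Fin.sum_univ_two, hx, hy]
    | add x y hx hy => simp [hx, hy]
  obtain ⟨h₁, h₂, h₃⟩ := h x
  ext i j
  fin_cases i <;> fin_cases j
  · simpa using h₁
  · rfl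
  · simpa using h₂
  · simpa using h₃

lemma deriv_mul (δ : ∀ n, M n →ₗ[ℚ] TA M) (x y : TA M) :
    deriv δ (x * y) = deriv δ x * y + parity x * deriv δ y := by
  have := congrFun (congrFun (map_mul (derivMat δ) x y) 0) 1
  rw [derivMat_apply, derivMat_apply, derivMat_apply] at this
  simpa [Matrix.mul_apply, Fin.sum_univ_two, add_comm] using this

@[simp] lemma deriv_one (δ : ∀ n, M n →ₗ[ℚ] TA M) : deriv δ 1 = 0 := by
  simp [deriv]

@[simp] lemma deriv_algebraMap (δ : ∀ n, M n →ₗ[ℚ] TA M) (r : ℚ) :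
    deriv δ (algebraMap ℚ (TA M) r) = 0 := by
  rw [Algebra.algebraMap_eq_smul_one, map_smul, deriv_one, smul_zero]

lemma induction_gen {C : TA M → Prop} (halg : ∀ r, C (algebraMap ℚ _ r))
    (hgen : ∀ n (x : M n), C (gen n x)) (hmul : ∀ x y, C x → C y → C (x * y))
    (hadd : ∀ x y, C x → C y → C (x + y)) (x : TA M) : C x := by
  induction x using TensorAlgebra.induction with
  | algebraMap r => exact halg r
  | ι v =>
    induction v using DirectSum.induction_on with
    | zero => simpa using halg 0
    | of n x => exact hgen n x
    | add x y hx hy => rw [map_add]; exact hadd _ _ hx hy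
  | mul x y hx hy => exact hmul _ _ hx hy
  | add x y hx hy => exact hadd _ _ hx hy

/-- A graded derivation of degree `-1` on generators has degree `-1`. -/
lemma deriv_mem (δ : ∀ n, M n →ₗ[ℚ] TA M) (h₀ : δ 0 = 0)
    (h : ∀ n x, δ (n + 1) x ∈ gr M n) :
    (∀ x ∈ gr M 0, deriv δ x = 0) ∧ ∀ n, ∀ x ∈ gr M (n + 1), deriv δ x ∈ gr M n := by
  have key : ∀ l : List (Σ n, M n),
      ((l.map Sigma.fst).sum = 0 → deriv δ (l.map fun p => gen p.1 p.2).prod = 0) ∧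
      ∀ n, (l.map Sigma.fst).sum = n + 1 →
        deriv δ (l.map fun p => gen p.1 p.2).prod ∈ gr M n := by
    intro l
    induction l with
    | nil => simp
    | cons p l ih =>
      obtain ⟨k, x⟩ := p
      have hl : (l.map fun p => gen p.1 p.2).prod ∈ gr M (l.map Sigma.fst).sum :=
        Submodule.subset_span ⟨l, rfl, rfl⟩
      simp only [List.map_cons, List.prod_cons, List.sum_cons, deriv_mul, deriv_gen,
        parity_of_mem (gen_mem x)]
      constructor
      · intro h0
        obtain ⟨rfl, h1⟩ : k = 0 ∧ (l.map Sigma.fst).sum = 0 := by omega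
        simp [h₀, ih.1 h1]
      · intro n hn
        refine add_mem ?_ ?_
        · rcases k with _ | k
          · simp [h₀]
          · have : n = k + (l.map Sigma.fst).sum := by omega
            rw [this]
            exact SetLike.mul_mem_graded (h k x) hl
        · rw [smul_mul_assoc]
          refine Submodule.smul_mem _ _ ?_
          rcases hs : (l.map Sigma.fst).sum with _ | s
          · rw [ih.1 hs]; simp
          · have : n = k + s := by omega
            rw [this]
            exact SetLike.mul_mem_graded (gen_mem x) (ih.2 s hs)
  constructor
  · intro x hx
    induction hx using Submodule.span_induction with
    | zero => simp
    | add x y hx hy ihx ihy => rw [map_add, ihx, ihy, add_zero]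
    | smul r x hx ih => rw [map_smul, ih, smul_zero]
    | mem x hx => obtain ⟨l, h0, rfl⟩ := hx; exact (key l).1 h0
  · intro n x hx
    induction hx using Submodule.span_induction with
    | zero => simp
    | add x y hx hy ihx ihy => rw [map_add]; exact add_mem ihx ihy
    | smul r x hx ih => rw [map_smul]; exact Submodule.smul_mem _ _ ih
    | mem x hx => obtain ⟨l, h0, rfl⟩ := hx; exact (key l).2 n h0

lemma deriv_deriv (δ : ∀ n, M n →ₗ[ℚ] TA M)
    (hp : ∀ n x, parity (δ n x) = - (-1 : ℚ) ^ n • δ n x)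
    (h : ∀ n x, deriv δ (δ n x) = 0) (x : TA M) : deriv δ (deriv δ x) = 0 := by
  have hpar : ∀ x, parity (deriv δ x) = - deriv δ (parity x) := by
    intro x
    induction x using induction_gen with
    | halg r => simp
    | hgen n x => simp [hp, parity_of_mem (gen_mem x)]
    | hmul x y hx hy =>
      rw [deriv_mul, map_add, map_mul, map_mul, hx, hy, map_mul parity x y, deriv_mul]
      noncomm_ring
    | hadd x y hx hy => simp [hx, hy, add_comm]
  induction x using induction_gen with
  | halg r => simp
  | hgen n x => simp [h]
  | hmul x y hx hy => simp [deriv_mul, hx, hy, hpar]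
  | hadd x y hx hy => simp [hx, hy]

end TA

end TensorAlg

section Cobar

variable {X : Type u} [TopologicalSpace X] {b : X}

/-- The underlying algebra of the cobar construction `Ω C_*(X, b; ℚ)`: the tensor algebra on the
desuspension `s⁻¹ C̄`, so that the generators of degree `n` are the normalized pointed chains of
degree `n + 1`. -/
abbrev Cobar (X : Type u) [TopologicalSpace X] (b : X) : Type u :=
  TA fun n => NChain X b (n + 1)

/-- The total grading of the cobar construction. -/
abbrev cobarGr (X : Type u) [TopologicalSpace X] (b : X) : ℕ → Submodule ℚ (Cobar X b) :=
  TA.gr fun n => NChain X b (n + 1)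

/-- The map `- s⁻¹ ∂ s + (s⁻¹ ⊗ s⁻¹) Δ s` on generators, with the Koszul sign
`(s⁻¹ ⊗ s⁻¹) (x ⊗ y) = (-1)^|x| s⁻¹ x ⊗ s⁻¹ y`. -/
def cobarDGen : ∀ n, NChain X b (n + 1) →ₗ[ℚ] Cobar X b
  | 0 => 0
  | m + 1 => - (TA.gen (M := fun n => NChain X b (n + 1)) m ∘ₗ NChain.bd (m + 1)) +
      ∑ i : Fin (m + 1), (-1 : ℚ) ^ ((i : ℕ) + 1) •
        (LinearMap.mul' ℚ (Cobar X b) ∘ₗ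
          TensorProduct.map (TA.gen (M := fun n => NChain X b (n + 1)) (i : ℕ))
            (TA.gen (M := fun n => NChain X b (n + 1)) (m - i)) ∘ₗ
          NChain.aw (p := i + 1) (q := m - i + 1) (by omega))

/-- The differential of the cobar construction. -/
def cobarD (X : Type u) [TopologicalSpace X] (b : X) : Cobar X b →ₗ[ℚ] Cobar X b :=
  TA.deriv cobarDGen

/-- The generator `[σ]` of the cobar construction given by a pointed simplex of dimension `n + 1`. -/
def cobarGen {n : ℕ} (σ : PSimplex X b (n + 1)) : Cobar X b :=
  TA.gen (M := fun n => NChain X b (n + 1)) n (NChain.of σ)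

lemma cobarGen_mem {n : ℕ} (σ : PSimplex X b (n + 1)) : cobarGen σ ∈ cobarGr X b n :=
  TA.gen_mem _

lemma cobarGen_eq_zero {n : ℕ} {σ : PSimplex X b (n + 1)} (h : σ.IsDegenerate) :
    cobarGen σ = 0 := by
  rw [cobarGen, NChain.of_eq_zero h, map_zero]

/-- The element of the cobar construction corresponding to the cube of paths of a simplex: it is
`[σ]`, except for `1`-simplices, where it is `1 + [σ]` (and `1` for the `0`-simplex). -/
def cubeGen : {n : ℕ} → PSimplex X b n → Cobar X b
  | 0, _ => 1
  | 1, σ => 1 + cobarGen σ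
  | _ + 2, σ => cobarGen σ

lemma cubeGen_eq_zero {n : ℕ} {σ : PSimplex X b n} (hn : 2 ≤ n) (h : σ.IsDegenerate) :
    cubeGen σ = 0 := by
  obtain ⟨n, rfl⟩ : ∃ k, n = k + 2 := ⟨n - 2, by omega⟩
  exact cobarGen_eq_zero h

lemma cubeGen_mem {n : ℕ} (σ : PSimplex X b n) : cubeGen σ ∈ cobarGr X b (n - 1) := by
  rcases n with _ | _ | n
  · exact SetLike.one_mem_graded (cobarGr X b)
  · exact add_mem (SetLike.one_mem_graded (cobarGr X b)) (cobarGen_mem σ)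
  · exact cobarGen_mem σ

lemma cobarD_gen_zero (σ : PSimplex X b 1) : cobarD X b (cobarGen σ) = 0 := by
  simp [cobarD, cobarGen, cobarDGen]

lemma cobarD_gen_succ {m : ℕ} (σ : PSimplex X b (m + 2)) :
    cobarD X b (cobarGen σ) = - ∑ i : Fin (m + 3), (-1 : ℚ) ^ (i : ℕ) • cobarGen (σ.face i) +
      ∑ i : Fin (m + 1), (-1 : ℚ) ^ ((i : ℕ) + 1) •
        (cobarGen (σ.front (p := i + 1) (q := m - i + 1) (by omega)) *
          cobarGen (σ.back (p := i + 1) (q := m - i + 1) (by omega))) := by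
  simp only [cobarD, cobarGen, TA.deriv_gen]
  simp only [cobarDGen, LinearMap.add_apply, LinearMap.neg_apply, LinearMap.comp_apply,
    LinearMap.sum_apply, LinearMap.smul_apply, NChain.bd, NChain.aw, NChain.lift_of, map_sum,
    map_smul, TensorProduct.map_tmul, LinearMap.mul'_apply]

/-- The generator of a simplex, `0` in dimension `0`. -/
def cobarGen' : {n : ℕ} → PSimplex X b n → Cobar X b
  | 0, _ => 0
  | _ + 1, σ => cobarGen σ

lemma cubeGen_eq {n : ℕ} (hn : 0 < n) (σ : PSimplex X b n) :
    cubeGen σ = cobarGen' σ + if n = 1 then 1 else 0 := by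
  rcases n with _ | _ | n
  · omega
  · simp [cubeGen, cobarGen', add_comm]
  · simp [cubeGen, cobarGen']

lemma pull_congr {β : Type*} (F : ∀ {k : ℕ}, PSimplex X b k → β) {n p p' : ℕ} (hp : p = p')
    (σ : PSimplex X b n) (f : Fin (p + 1) → Fin (n + 1)) (f' : Fin (p' + 1) → Fin (n + 1))
    (h : ∀ (i : ℕ) (hi : i < p + 1) (hi' : i < p' + 1), (f ⟨i, hi⟩ : ℕ) = f' ⟨i, hi'⟩) :
    F (σ.pull f) = F (σ.pull f') := by
  subst hp
  congr 2
  funext i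
  exact Fin.ext (h i i.2 i.2)

/-- `D` in terms of the elements `cubeGen`: the differential of a cube. -/
lemma cobarD_cubeGen {m : ℕ} (σ : PSimplex X b (m + 1)) :
    cobarD X b (cubeGen σ) = ∑ i : Fin m, (-1 : ℚ) ^ (i : ℕ) •
      (cubeGen (σ.face (n := m) i.succ.castSucc) -
        cubeGen (σ.front (p := i + 1) (q := m - i) (by omega)) *
          cubeGen (σ.back (p := i + 1) (q := m - i) (by omega))) := by
  rcases m with _ | k
  · have : cobarD X b 1 = 0 := TA.deriv_one _
    simp [cubeGen, this, cobarD_gen_zero]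
  have e : ∀ i : Fin (k + 1), (-1 : ℚ) ^ (i : ℕ) •
      (cubeGen (σ.face (n := k + 1) i.succ.castSucc) -
        cubeGen (σ.front (p := i + 1) (q := k + 1 - i) (by omega)) *
          cubeGen (σ.back (p := i + 1) (q := k + 1 - i) (by omega))) =
      (-1 : ℚ) ^ (i : ℕ) • cobarGen (σ.face i.succ.castSucc) -
      (-1 : ℚ) ^ (i : ℕ) • (cobarGen (σ.front (p := i + 1) (q := k - i + 1) (by omega)) *
          cobarGen (σ.back (p := i + 1) (q := k - i + 1) (by omega))) -
      (if i = 0 then cobarGen (σ.face 0) else 0) -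
      (if i = Fin.last k then (-1 : ℚ) ^ k • cobarGen (σ.face (Fin.last _)) else 0) := by
    intro i
    have hF : cobarGen' (σ.front (p := i + 1) (q := k + 1 - i) (by omega)) =
      cobarGen (σ.front (p := i + 1) (q := k - i + 1) (by omega)) := rfl
    have hB : cobarGen' (σ.back (p := i + 1) (q := k + 1 - i) (by omega)) =
      cobarGen (σ.back (p := i + 1) (q := k - i + 1) (by omega)) :=
      pull_congr (p := k + 1 - i) (p' := k - i + 1) cobarGen' (by omega) σ
        (fun j => ⟨i + 1 + j, by omega⟩) (fun j => ⟨i + 1 + j, by omega⟩) (fun _ _ _ => rfl)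
    have hface : cobarGen' (σ.face (n := k + 1) i.succ.castSucc) =
      cobarGen (σ.face i.succ.castSucc) := rfl
    rw [cubeGen_eq (by omega), cubeGen_eq (by omega), cubeGen_eq (by omega), hF, hB, hface]
    have h1 : ((i : ℕ) + 1 = 1) = (i = 0) := by
      simp only [Fin.ext_iff, Fin.val_zero, eq_iff_iff]; omega
    have h2 : (k + 1 - (i : ℕ) = 1) = (i = Fin.last k) := by
      simp only [Fin.ext_iff, Fin.val_last, eq_iff_iff]; omega
    have h3 : (k + 1 = 1) = (i = 0 ∧ i = Fin.last k) := by
      simp only [Fin.ext_iff, Fin.val_last, eq_iff_iff, Fin.val_zero]; omega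
    have hB0 : i = 0 → cobarGen (σ.back (p := i + 1) (q := k - i + 1) (by omega)) =
        cobarGen (σ.face 0) := by
      rintro rfl
      refine pull_congr (p := k - 0 + 1) (p' := k + 1) cobarGen' rfl σ
        (fun j => ⟨0 + 1 + j, by omega⟩) (Fin.succAbove 0) (fun i _ _ => ?_)
      simp [add_comm]
    have hFl : i = Fin.last k → cobarGen (σ.front (p := i + 1) (q := k - i + 1) (by omega)) =
        cobarGen (σ.face (Fin.last _)) := by
      rintro rfl
      refine pull_congr (p := k + 1) (p' := k + 1) cobarGen' rfl σ
        (fun j => ⟨j, by omega⟩) (Fin.succAbove (Fin.last _)) (fun i _ _ => ?_)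
      simp
    simp only [h1, h2, h3]
    by_cases c0 : i = 0 <;> by_cases cl : i = Fin.last k
    · have hk : k = 0 := by
        rw [c0] at cl; simpa [Fin.ext_iff] using cl.symm
      rw [if_pos ⟨c0, cl⟩, if_pos c0, if_pos cl, if_pos c0, if_pos cl, hB0 c0, hFl cl]
      have hs : (-1 : ℚ) ^ (i : ℕ) = 1 := by simp [c0]
      have hs' : (-1 : ℚ) ^ k = 1 := by simp [hk]
      rw [hs, hs']
      simp only [one_smul]
      noncomm_ring
    · rw [if_neg (by tauto), if_pos c0, if_neg cl, if_pos c0, if_neg cl, hB0 c0]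
      have hs : (-1 : ℚ) ^ (i : ℕ) = 1 := by simp [c0]
      rw [hs]
      simp only [one_smul]
      noncomm_ring
    · rw [if_neg (by tauto), if_neg c0, if_pos cl, if_neg c0, if_pos cl, hFl cl]
      have hs : (-1 : ℚ) ^ (i : ℕ) = (-1 : ℚ) ^ k := by simp [cl]
      rw [hs, ← smul_sub, sub_zero, ← smul_sub]
      congr 1
      noncomm_ring
    · rw [if_neg (by tauto), if_neg c0, if_neg cl, if_neg c0, if_neg cl]
      simp [smul_sub]
  rw [Finset.sum_congr rfl fun i _ => e i]
  simp only [Finset.sum_sub_distrib, Finset.sum_ite_eq', Finset.mem_univ, if_true]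
  have h : cobarD X b (cubeGen σ) = cobarD X b (cobarGen σ) := rfl
  rw [h, cobarD_gen_succ, Fin.sum_univ_succ, Fin.sum_univ_castSucc]
  simp only [pow_succ, mul_neg, mul_one, neg_smul, Finset.sum_neg_distrib, Fin.val_zero, pow_zero,
    one_smul, Fin.val_succ, Fin.val_castSucc, Fin.val_last, Fin.succ_last, Fin.succ_castSucc,
    neg_neg]
  abel

/-- `cubeGen` of the face of `σ` with vertices `f 0, …, f p`. -/
def faceGen {N : ℕ} (σ : PSimplex X b N) (p : ℕ) (f : ℕ → ℕ) : Cobar X b :=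
  cubeGen (σ.pull fun i : Fin (p + 1) => Fin.ofNat (N + 1) (f i))

lemma faceGen_congr {N : ℕ} (σ : PSimplex X b N) {p : ℕ} {f g : ℕ → ℕ}
    (h : ∀ k ≤ p, f k = g k) : faceGen σ p f = faceGen σ p g := by
  unfold faceGen
  congr 2
  funext i
  rw [h i (by omega)]

lemma faceGen_id {N : ℕ} (σ : PSimplex X b N) : faceGen σ N id = cubeGen σ := by
  unfold faceGen
  congr 1
  convert PSimplex.pull_id σ using 2
  funext i
  simp

lemma faceGen_mem {N : ℕ} (σ : PSimplex X b N) (p : ℕ) (f : ℕ → ℕ) :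
    faceGen σ p f ∈ cobarGr X b (p - 1) := cubeGen_mem _

/-- The map `ℕ → ℕ` that skips `i`. -/
def skip (i k : ℕ) : ℕ := if k < i then k else k + 1

lemma cobarD_faceGen {N : ℕ} (σ : PSimplex X b N) (p : ℕ) (f : ℕ → ℕ) :
    cobarD X b (faceGen σ p f) = ∑ i ∈ Finset.range (p - 1), (-1 : ℚ) ^ i •
      (faceGen σ (p - 1) (f ∘ skip (i + 1)) -
        faceGen σ (i + 1) f * faceGen σ (p - 1 - i) (fun k => f (i + 1 + k))) := by
  rcases p with _ | m
  · have : cobarD X b 1 = 0 := TA.deriv_one _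
    simpa [faceGen, cubeGen] using this
  rw [faceGen, cobarD_cubeGen, Nat.add_sub_cancel, ← Fin.sum_univ_eq_sum_range (fun i =>
    (-1 : ℚ) ^ i • (faceGen σ m (f ∘ skip (i + 1)) -
        faceGen σ (i + 1) f * faceGen σ (m - i) (fun k => f (i + 1 + k))))]
  refine Finset.sum_congr rfl fun i _ => ?_
  congr 2
  · rw [PSimplex.face, PSimplex.pull_pull, faceGen]
    congr 2
    funext k
    simp only [Function.comp, skip, Fin.succAbove, Fin.lt_def, Fin.val_castSucc, Fin.val_succ]
    split_ifs <;> rfl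
  · rw [PSimplex.front, PSimplex.pull_pull, PSimplex.back, PSimplex.pull_pull]
    rfl

lemma sum_sum_alternating {W : Type*} [AddCommGroup W] [Module ℚ W] (P : ℕ) (K : ℕ → ℕ → W)
    (h : ∀ i j, i ≤ j → j < P → K i j = K (j + 1) i) :
    ∑ i ∈ Finset.range (P + 1), ∑ j ∈ Finset.range P, (-1 : ℚ) ^ (i + j) • K i j = 0 := by
  rw [← Finset.sum_product', ← Finset.sum_filter_add_sum_filter_not _ (fun x => x.1 ≤ x.2),
    add_eq_zero_iff_eq_neg, ← Finset.sum_neg_distrib]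
  refine Finset.sum_bij' (fun x _ => (x.2 + 1, x.1)) (fun x _ => (x.2, x.1 - 1)) ?_ ?_ ?_ ?_ ?_
  · rintro ⟨i, j⟩ hx
    simp only [Finset.mem_filter, Finset.mem_product, Finset.mem_range] at hx ⊢
    omega
  · rintro ⟨i, j⟩ hx
    simp only [Finset.mem_filter, Finset.mem_product, Finset.mem_range] at hx ⊢
    omega
  · rintro ⟨i, j⟩ hx
    simp
  · rintro ⟨i, j⟩ hx
    simp only [Finset.mem_filter, Finset.mem_product, Finset.mem_range] at hx
    simp only [Prod.mk.injEq, and_true]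
    omega
  · rintro ⟨i, j⟩ hx
    simp only [Finset.mem_filter, Finset.mem_product, Finset.mem_range] at hx
    simp only
    rw [h i j hx.2 hx.1.2, show j + 1 + i = i + j + 1 by omega, pow_succ]
    simp

/-- The two-fold faces of a cube of paths. -/
def faceFace {N : ℕ} (σ : PSimplex X b N) (P : ℕ) (f : ℕ → ℕ) (i j : ℕ) : Cobar X b :=
  faceGen σ P (f ∘ skip (i + 1) ∘ skip (j + 1)) -
    faceGen σ (j + 1) (f ∘ skip (i + 1)) *
      faceGen σ (P - j) (fun k => f (skip (i + 1) (j + 1 + k))) -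
    if j < i then
      (faceGen σ i (f ∘ skip (j + 1)) -
        faceGen σ (j + 1) f * faceGen σ (i - j) (fun k => f (j + 1 + k))) *
          faceGen σ (P + 1 - i) (fun k => f (i + 1 + k))
    else
      faceGen σ (i + 1) f *
        (faceGen σ (P - i) (fun k => f (i + 1 + skip (j - i + 1) k)) -
          faceGen σ (j - i + 1) (fun k => f (i + 1 + k)) *
            faceGen σ (P - j) (fun k => f (j + 2 + k)))

lemma faceFace_symm {N : ℕ} (σ : PSimplex X b N) (P : ℕ) (f : ℕ → ℕ) (i j : ℕ) (hij : i ≤ j)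
    (hj : j < P) : faceFace σ P f i j = faceFace σ P f (j + 1) i := by
  rw [faceFace, faceFace, if_neg (by omega), if_pos (by omega)]
  have e1 : f ∘ skip (i + 1) ∘ skip (j + 1) = f ∘ skip (j + 1 + 1) ∘ skip (i + 1) := by
    funext k
    simp only [Function.comp, skip]
    congr 1
    split_ifs <;> omega
  have e2 : (fun k => f (skip (i + 1) (j + 1 + k))) = fun k => f (j + 1 + 1 + k) := by
    funext k
    congr 1
    simp only [skip]
    split_ifs <;> omega
  have e3 : faceGen σ (i + 1) (f ∘ skip (j + 1 + 1)) = faceGen σ (i + 1) f :=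
    faceGen_congr σ fun k hk => by
      simp only [Function.comp, skip]; rw [if_pos (by omega)]
  have e4 : (fun k => f (skip (j + 1 + 1) (i + 1 + k))) =
      fun k => f (i + 1 + skip (j - i + 1) k) := by
    funext k
    congr 1
    simp only [skip]
    split_ifs <;> omega
  rw [e1, e2, e3, e4, show P + 1 - (j + 1) = P - j by omega, show j + 1 - i = j - i + 1 by omega]
  noncomm_ring

lemma cobarD_cobarD_faceGen {N : ℕ} (σ : PSimplex X b N) (P : ℕ) (f : ℕ → ℕ) :
    cobarD X b (cobarD X b (faceGen σ (P + 2) f)) = 0 := by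
  rw [← sum_sum_alternating P (faceFace σ P f) (faceFace_symm σ P f), cobarD_faceGen]
  simp only [map_sum, map_smul, map_sub]
  refine Finset.sum_congr rfl fun i hi => ?_
  rw [Finset.mem_range] at hi
  have hi : i ≤ P := by omega
  simp only [pow_add, mul_smul, ← Finset.smul_sum]
  congr 1
  rw [cobarD, TA.deriv_mul, ← cobarD, TA.parity_of_mem (faceGen_mem σ (i + 1) f),
    cobarD_faceGen, cobarD_faceGen, cobarD_faceGen]
  simp only [Nat.add_sub_cancel, show P + 2 - 1 - i - 1 = P - i by omega,
    show P + 2 - 1 - 1 = P by omega]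
  have hsplit : ∀ g : ℕ → Cobar X b, ∑ j ∈ Finset.range P, g j =
      ∑ j ∈ Finset.range i, g j + ∑ j ∈ Finset.range (P - i), g (i + j) := by
    intro g
    rw [← Finset.sum_range_add_sum_Ico g hi, Finset.sum_Ico_eq_sum_range]
  rw [hsplit, hsplit]
  have e1 : ∀ j ∈ Finset.range i, (-1 : ℚ) ^ j • faceFace σ P f i j =
      (-1 : ℚ) ^ j • (faceGen σ P ((f ∘ skip (i + 1)) ∘ skip (j + 1)) -
        faceGen σ (j + 1) (f ∘ skip (i + 1)) *
          faceGen σ (P - j) (fun k => (f ∘ skip (i + 1)) (j + 1 + k))) -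
      ((-1 : ℚ) ^ j • (faceGen σ i (f ∘ skip (j + 1)) -
        faceGen σ (j + 1) f * faceGen σ (i - j) (fun k => f (j + 1 + k)))) *
          faceGen σ (P + 2 - 1 - i) (fun k => f (i + 1 + k)) := by
    intro j hj
    rw [faceFace, if_pos (Finset.mem_range.1 hj), smul_sub, smul_mul_assoc]
    rfl
  have e2 : ∀ j ∈ Finset.range (P - i), (-1 : ℚ) ^ (i + j) • faceFace σ P f i (i + j) =
      (-1 : ℚ) ^ (i + j) • (faceGen σ P ((f ∘ skip (i + 1)) ∘ skip (i + j + 1)) -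
        faceGen σ (i + j + 1) (f ∘ skip (i + 1)) *
          faceGen σ (P - (i + j)) (fun k => (f ∘ skip (i + 1)) (i + j + 1 + k))) -
      ((-1 : ℚ) ^ i • faceGen σ (i + 1) f) * ((-1 : ℚ) ^ j •
        (faceGen σ (P - i) ((fun k => f (i + 1 + k)) ∘ skip (j + 1)) -
          faceGen σ (j + 1) (fun k => f (i + 1 + k)) *
            faceGen σ (P - i - j) (fun k => f (i + 1 + (j + 1 + k))))) := by
    intro j _
    rw [faceFace, if_neg (by omega), smul_sub, smul_mul_smul_comm, ← pow_add,
      show i + j - i = j by omega, show P - (i + j) = P - i - j by omega]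
    simp only [show ∀ k, i + j + 2 + k = i + 1 + (j + 1 + k) by omega]
    rfl
  rw [Finset.sum_congr rfl e1, Finset.sum_congr rfl e2, Finset.sum_sub_distrib,
    Finset.sum_sub_distrib, ← Finset.sum_mul, ← Finset.mul_sum]
  abel

end Cobar

section TAaux

variable {M : ℕ → Type u} [∀ n, AddCommGroup (M n)] [∀ n, Module ℚ (M n)]

lemma TA.kills_pos {W : Type*} [Ring W] [Algebra ℚ W] (f : TA M →ₐ[ℚ] W)
    (h : ∀ n x, f (TA.gen (n + 1) x) = 0) {k : ℕ} {x : TA M} (hx : x ∈ TA.gr M (k + 1)) :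
    f x = 0 := by
  have key : ∀ l : List (Σ n, M n), 0 < (l.map Sigma.fst).sum →
      f (l.map fun p => TA.gen p.1 p.2).prod = 0 := by
    intro l
    induction l with
    | nil => simp
    | cons p l ih =>
      obtain ⟨n, x⟩ := p
      intro hl
      simp only [List.map_cons, List.prod_cons, List.sum_cons, map_mul] at hl ⊢
      rcases n with _ | n
      · rw [ih (by omega), mul_zero]
      · rw [h, zero_mul]
  induction hx using Submodule.span_induction with
  | zero => simp
  | add x y hx hy ihx ihy => rw [map_add, ihx, ihy, add_zero]
  | smul r x hx ih => rw [map_smul, ih, smul_zero]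
  | mem x hx => obtain ⟨l, hl, rfl⟩ := hx; exact key l (by omega)

end TAaux

section Cobar

variable {X : Type u} [TopologicalSpace X] {b : X}

lemma cobarDGen_mem (n : ℕ) (x : NChain X b (n + 2)) :
    cobarDGen (n + 1) x ∈ cobarGr X b n := by
  simp only [cobarDGen, LinearMap.add_apply, LinearMap.neg_apply, LinearMap.comp_apply,
    LinearMap.sum_apply, LinearMap.smul_apply]
  refine add_mem (neg_mem (TA.gen_mem _)) (sum_mem fun i _ => Submodule.smul_mem _ _ ?_)
  have key : ∀ t : NChain X b (i + 1) ⊗[ℚ] NChain X b (n - i + 1),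
      LinearMap.mul' ℚ (Cobar X b) (TensorProduct.map
        (TA.gen (M := fun n => NChain X b (n + 1)) (i : ℕ))
        (TA.gen (M := fun n => NChain X b (n + 1)) (n - i)) t) ∈ cobarGr X b n := by
    intro t
    induction t using TensorProduct.induction_on with
    | zero => simp
    | tmul x y =>
      have := SetLike.mul_mem_graded (A := cobarGr X b)
        (TA.gen_mem (M := fun n => NChain X b (n + 1)) x)
        (TA.gen_mem (M := fun n => NChain X b (n + 1)) y)
      rw [show (i : ℕ) + (n - i) = n by omega] at this
      simpa using this
    | add x y hx hy => simpa only [map_add] using add_mem hx hy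
  exact key _

lemma cobarD_cobarD_gen {n : ℕ} (σ : PSimplex X b (n + 1)) :
    cobarD X b (cobarD X b (cobarGen σ)) = 0 := by
  rcases n with _ | P
  · rw [cobarD_gen_zero, map_zero]
  · have : cobarGen σ = faceGen σ (P + 2) id := (faceGen_id σ).symm
    rw [this, cobarD_cobarD_faceGen]

/-- The cobar construction is a differential graded algebra. -/
instance : IsDGAlgebra (cobarGr X b) (cobarD X b) where
  d_mem {n a} h := (TA.deriv_mem cobarDGen rfl cobarDGen_mem).2 n a h
  d_zero {a} h := (TA.deriv_mem cobarDGen rfl cobarDGen_mem).1 a h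
  leibniz {n a} c h := by
    rw [cobarD, TA.deriv_mul, TA.parity_of_mem h, smul_mul_assoc]
  d_d a := by
    refine TA.deriv_deriv cobarDGen ?_ ?_ a
    · intro n x
      rcases n with _ | n
      · simp [cobarDGen]
      · rw [TA.parity_of_mem (cobarDGen_mem n x), pow_succ]
        simp
    · intro n x
      have : (cobarD X b ∘ₗ cobarDGen n) = 0 := NChain.hom_ext fun σ => by
        have := cobarD_cobarD_gen σ
        rw [cobarGen] at this
        nth_rewrite 2 [cobarD] at this
        rw [TA.deriv_gen] at this
        exact this
      exact LinearMap.congr_fun this x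

lemma cobar_hom_ext {W : Type*} [Ring W] [Algebra ℚ W] {f g : Cobar X b →ₐ[ℚ] W}
    (h : ∀ n (σ : PSimplex X b (n + 1)), f (cobarGen σ) = g (cobarGen σ)) : f = g := by
  refine TA.hom_ext fun n x => ?_
  have : f.toLinearMap ∘ₗ TA.gen (M := fun n => NChain X b (n + 1)) n =
    g.toLinearMap ∘ₗ TA.gen (M := fun n => NChain X b (n + 1)) n :=
      NChain.hom_ext fun σ => h n σ
  exact LinearMap.congr_fun this x

lemma gen_eq_zero_of {W : Type*} [Ring W] [Algebra ℚ W] (f : Cobar X b →ₐ[ℚ] W) {n : ℕ}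
    (h : ∀ σ : PSimplex X b (n + 1), f (cobarGen σ) = 0) (x : NChain X b (n + 1)) :
    f (TA.gen (M := fun n => NChain X b (n + 1)) n x) = 0 := by
  have : f.toLinearMap ∘ₗ TA.gen (M := fun n => NChain X b (n + 1)) n = 0 :=
      NChain.hom_ext fun σ => h σ
  exact LinearMap.congr_fun this x

lemma cobar_kills_pos {W : Type*} [Ring W] [Algebra ℚ W] (f : Cobar X b →ₐ[ℚ] W)
    (h : ∀ n (σ : PSimplex X b (n + 2)), f (cobarGen σ) = 0) {k : ℕ} {x : Cobar X b}
    (hx : x ∈ cobarGr X b (k + 1)) : f x = 0 :=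
  TA.kills_pos f (fun n x => gen_eq_zero_of f (n := n + 1) (h n) x) hx

/-- An algebra map which vanishes in positive degrees and is compatible with all `2`-simplices
vanishes on boundaries. -/
lemma comp_cobarD_eq_zero {W : Type*} [Ring W] [Algebra ℚ W] (f : Cobar X b →ₐ[ℚ] W)
    (h₀ : ∀ n (σ : PSimplex X b (n + 2)), f (cobarGen σ) = 0)
    (h₁ : ∀ σ : PSimplex X b 2, f (cubeGen (σ.face 1)) =
      f (cubeGen (σ.front (p := 1) (q := 1) rfl)) * f (cubeGen (σ.back (p := 1) (q := 1) rfl)))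
    (x : Cobar X b) : f (cobarD X b x) = 0 := by
  induction x using TA.induction_gen with
  | halg r => simp [cobarD]
  | hmul x y hx hy =>
    rw [cobarD, TA.deriv_mul, ← cobarD, map_add, map_mul, map_mul, hx, hy, zero_mul, mul_zero,
      add_zero]
  | hadd x y hx hy => rw [map_add, map_add, hx, hy, add_zero]
  | hgen n x =>
    have : f.toLinearMap ∘ₗ cobarD X b ∘ₗ TA.gen (M := fun n => NChain X b (n + 1)) n = 0 := by
      refine NChain.hom_ext fun σ => ?_
      change f (cobarD X b (cobarGen σ)) = 0
      rcases n with _ | _ | n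
      · rw [cobarD_gen_zero, map_zero]
      · change f (cobarD X b (cubeGen σ)) = 0
        rw [cobarD_cubeGen]
        simp only [Fin.sum_univ_one, Fin.val_zero, pow_zero, one_smul, map_sub, map_mul]
        exact sub_eq_zero.2 (h₁ σ)
      · exact cobar_kills_pos f h₀
          (IsDGAlgebra.d_mem (𝒜 := cobarGr X b) (d := cobarD X b) (cobarGen_mem σ))
    exact LinearMap.congr_fun this x

/-- The augmentation of the cobar construction: the projection onto tensors of length zero. -/
def cobarAug (X : Type u) [TopologicalSpace X] (b : X) : Cobar X b →ₐ[ℚ] ℚ :=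
  TA.lift fun _ => 0

@[simp] lemma cobarAug_gen {n : ℕ} (σ : PSimplex X b (n + 1)) : cobarAug X b (cobarGen σ) = 0 := by
  simp [cobarAug, cobarGen]

/-- The zeroth homology algebra of the cobar construction. -/
abbrev H0Cobar (X : Type u) [TopologicalSpace X] (b : X) : Type u :=
  H0 (cobarGr X b) (cobarD X b)

/-- The projection of the cobar construction onto its degree zero part, followed by the projection
onto homology. -/
def cobarPi (X : Type u) [TopologicalSpace X] (b : X) : Cobar X b →ₐ[ℚ] H0Cobar X b :=
  TA.lift fun n => match n with
    | 0 => (H0.mk (cobarGr X b) (cobarD X b)).toLinearMap ∘ₗ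
        (TA.gen (M := fun n => NChain X b (n + 1)) 0).codRestrict
          (Subalgebra.toSubmodule (cycles₀ (cobarGr X b) (cobarD X b)))
          (fun x => (cycle (cobarGr X b) (cobarD X b) _ (TA.gen_mem (M := fun n => NChain X b (n + 1)) (n := 0) x)).2)
    | _ + 1 => 0

lemma cobarPi_of_pos {n : ℕ} {x : Cobar X b} (hx : x ∈ cobarGr X b (n + 1)) :
    cobarPi X b x = 0 :=
  TA.kills_pos _ (fun n x => by simp [cobarPi]) hx

lemma cobarPi_cycle (z : cycles₀ (cobarGr X b) (cobarD X b)) :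
    cobarPi X b z = H0.mk (cobarGr X b) (cobarD X b) z := by
  have key : ∀ (x : Cobar X b) (hx : x ∈ cobarGr X b 0), cobarPi X b x =
      H0.mk (cobarGr X b) (cobarD X b) (cycle (cobarGr X b) (cobarD X b) x hx) := by
    intro x hx
    induction hx using Submodule.span_induction with
    | zero => rw [map_zero]; exact (map_zero (H0.mk (cobarGr X b) (cobarD X b))).symm
    | add x y hx hy ihx ihy =>
      rw [map_add, ihx, ihy]; exact (map_add (H0.mk (cobarGr X b) (cobarD X b)) _ _).symm
    | smul r x hx ih =>
      rw [map_smul, ih]; exact (map_smul (H0.mk (cobarGr X b) (cobarD X b)) _ _).symm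
    | mem x hx =>
      obtain ⟨l, hl, rfl⟩ := hx
      induction l with
      | nil =>
        simp only [List.map_nil, List.prod_nil, map_one]
        exact (map_one (H0.mk (cobarGr X b) (cobarD X b))).symm
      | cons p l ih =>
        obtain ⟨n, x⟩ := p
        simp only [List.map_cons, List.sum_cons] at hl
        obtain ⟨rfl, hl'⟩ : n = 0 ∧ (l.map Sigma.fst).sum = 0 := by omega
        simp only [List.map_cons, List.prod_cons, map_mul]
        rw [ih hl']
        have : cobarPi X b (TA.gen (M := fun n => NChain X b (n + 1)) 0 x) =
          H0.mk (cobarGr X b) (cobarD X b)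
            (cycle (cobarGr X b) (cobarD X b) _ (TA.gen_mem (M := fun n => NChain X b (n + 1)) (n := 0) x)) := by
          rw [cobarPi, TA.lift_gen]; rfl
        rw [this]
        exact (map_mul (H0.mk (cobarGr X b) (cobarD X b)) _ _).symm
  exact key z z.2.1

/-- The class of `1 + [σ]` for a pointed `1`-simplex `σ`. -/
def edge (σ : PSimplex X b 1) : H0Cobar X b :=
  H0.mk (cobarGr X b) (cobarD X b)
    (cycle (cobarGr X b) (cobarD X b) (cubeGen σ) (cubeGen_mem σ))

lemma cobarPi_cubeGen (σ : PSimplex X b 1) : cobarPi X b (cubeGen σ) = edge σ :=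
  cobarPi_cycle (cycle (cobarGr X b) (cobarD X b) (cubeGen σ) (cubeGen_mem σ))

lemma H0Cobar.hom_ext {W : Type*} [Ring W] [Algebra ℚ W] {f g : H0Cobar X b →ₐ[ℚ] W}
    (h : ∀ σ : PSimplex X b 1, f (edge σ) = g (edge σ)) : f = g := by
  have : f.comp (cobarPi X b) = g.comp (cobarPi X b) := by
    refine cobar_hom_ext fun n σ => ?_
    simp only [AlgHom.comp_apply]
    rcases n with _ | n
    · have := h σ
      rw [← cobarPi_cubeGen, cubeGen] at this
      simpa using this
    · rw [cobarPi_of_pos (cobarGen_mem σ), map_zero, map_zero]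
  ext x
  obtain ⟨z, rfl⟩ := H0.mk_surjective _ _ x
  rw [← cobarPi_cycle]
  exact AlgHom.congr_fun this (z : Cobar X b)

lemma edge_face (σ : PSimplex X b 2) : edge (σ.face 1) =
    edge (σ.front (p := 1) (q := 1) rfl) * edge (σ.back (p := 1) (q := 1) rfl) := by
  rw [edge, edge, edge, ← map_mul, ← sub_eq_zero, ← map_sub, H0.mk_eq_zero]
  refine ⟨cubeGen σ, cubeGen_mem σ, ?_⟩
  rw [cobarD_cubeGen]
  simp only [Fin.sum_univ_one, Fin.val_zero, pow_zero, one_smul]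
  rfl

end Cobar

section Coproduct

variable {X : Type u} [TopologicalSpace X] {b : X}

/-- For a composition `c` of `n`, the face of `σ` spanned by the end points of the blocks. -/
def PSimplex.outer {n : ℕ} (σ : PSimplex X b n) (c : Composition n) : PSimplex X b c.length :=
  σ.pull c.boundary

/-- For a composition `c` of `n`, the face of `σ` spanned by the consecutive vertices of the `i`-th
block, end points included. -/
def PSimplex.block {n : ℕ} (σ : PSimplex X b n) (c : Composition n) (i : Fin c.length) :
    PSimplex X b (c.blocksFun i) :=
  σ.pull fun k => ⟨c.sizeUpTo i + k, by
    have h₁ := c.sizeUpTo_succ' i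
    have h₂ := c.sizeUpTo_le (i + 1)
    have h₃ := k.2
    omega⟩

/-- The summand of the cubical diagonal of `σ` given by the composition with end points
`0 = b₀ < b₁ < ⋯ < b_k = n`: up to the sign of the corresponding shuffle, it is the tensor product
of the outer face and the concatenation of the blocks. -/
def nablaTerm {n : ℕ} (σ : PSimplex X b n) (c : Composition n) :
    cobarGr X b ᵍ⊗[ℚ] cobarGr X b :=
  (-1 : ℚ) ^ (∑ j ∈ Finset.range c.length, (c.sizeUpTo j - j)) •
    GradedTensorProduct.tmul ℚ (cubeGen (σ.outer c))
      (List.ofFn fun i : Fin c.length => cubeGen (σ.block c i)).prod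

lemma nablaTerm_eq_zero {n : ℕ} {σ : PSimplex X b (n + 2)} (h : σ.IsDegenerate)
    (c : Composition (n + 2)) : nablaTerm σ c = 0 := by
  obtain ⟨j, τ, rfl⟩ := h
  have hlen : 0 < c.length := c.length_pos_iff.2 (by omega)
  set i := c.index j with hi
  have h₁ : (j : ℕ) < c.sizeUpTo (i + 1) := c.lt_sizeUpTo_index_succ j
  have h₂ : c.sizeUpTo i ≤ j := c.sizeUpTo_index_le j
  have h₃ := c.sizeUpTo_succ' i
  by_cases hb : 2 ≤ c.blocksFun i
  · have : cubeGen ((τ.degen j).block c i) = 0 := by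
      refine cubeGen_eq_zero hb ?_
      have key : ∀ {m : ℕ} (f : Fin (m + 1) → Fin (n + 2 + 1)) (_ : 2 ≤ m)
          (k : ℕ) (_ : k + 1 < m + 1), (∀ (l : ℕ) (hl : l < m + 1), (f ⟨l, hl⟩ : ℕ) = c.sizeUpTo i + l) →
          c.sizeUpTo i + k = j → ((τ.degen j).pull f).IsDegenerate := by
        intro m f hm k hk hf hkj
        obtain ⟨m, rfl⟩ : ∃ m', m = m' + 1 := ⟨m - 1, by omega⟩
        refine PSimplex.isDegenerate_degen_pull τ j f ⟨k, by omega⟩ ?_ ?_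
        · refine Fin.ext ((hf k (by omega)).trans ?_)
          simpa using hkj
        · refine Fin.ext ((hf (k + 1) (by omega)).trans ?_)
          simp only [Fin.val_succ]; omega
      exact key _ hb (j - c.sizeUpTo i) (by omega) (fun _ _ => rfl) (by omega)
    rw [nablaTerm, List.prod_eq_zero (List.mem_ofFn.2 ⟨i, this⟩), GradedTensorProduct.tmul,
      TensorProduct.tmul_zero, map_zero,
      smul_zero]
  · have h1 : c.blocksFun i = 1 := le_antisymm (by omega) (c.one_le_blocksFun i)
    have hlen2 : 2 ≤ c.length := by
      by_contra hcon
      have hl : c.length = 1 := by omega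
      have hi0 : (i : ℕ) = 0 := by omega
      have h4 : c.sizeUpTo (i + 1) = n + 2 := c.sizeUpTo_ofLength_le _ (by omega)
      have h5 : c.sizeUpTo i = 0 := by rw [hi0, c.sizeUpTo_zero]
      omega
    have : cubeGen ((τ.degen j).outer c) = 0 := by
      refine cubeGen_eq_zero hlen2 ?_
      have key : ∀ {m : ℕ} (f : Fin (m + 1) → Fin (n + 2 + 1)) (_ : 2 ≤ m)
          (k : ℕ) (_ : k + 1 < m + 1), (∀ (l : ℕ) (hl : l < m + 1), (f ⟨l, hl⟩ : ℕ) = c.sizeUpTo l) →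
          c.sizeUpTo k = j → c.sizeUpTo (k + 1) = j + 1 → ((τ.degen j).pull f).IsDegenerate := by
        intro m f hm k hk hf hkj hkj'
        obtain ⟨m, rfl⟩ : ∃ m', m = m' + 1 := ⟨m - 1, by omega⟩
        refine PSimplex.isDegenerate_degen_pull τ j f ⟨k, by omega⟩ ?_ ?_
        · refine Fin.ext ((hf k (by omega)).trans ?_)
          simpa using hkj
        · refine Fin.ext ((hf (k + 1) (by omega)).trans ?_)
          simpa using hkj'
      exact key _ hlen2 i (by omega) (fun _ _ => rfl) (by omega) (by omega)
    rw [nablaTerm, this, GradedTensorProduct.tmul, TensorProduct.zero_tmul, map_zero, smul_zero]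

/-- The only summand for a `1`-simplex. -/
lemma nablaTerm_one (σ : PSimplex X b 1) (c : Composition 1) :
    nablaTerm σ c = GradedTensorProduct.tmul ℚ (cubeGen σ) (cubeGen σ) := by
  have hl : c.length = 1 := le_antisymm c.length_le (c.length_pos_iff.2 one_pos)
  have hs : ∀ i ≤ 1, c.sizeUpTo i = i := by
    intro i hi
    obtain rfl | rfl : i = 0 ∨ i = 1 := by omega
    · exact c.sizeUpTo_zero
    · exact c.sizeUpTo_ofLength_le 1 hl.le
  have h₁ : cubeGen (σ.outer c) = cubeGen σ :=
    (pull_congr cubeGen hl σ c.boundary id fun i hi _ => hs i (by omega)).trans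
      (congrArg cubeGen σ.pull_id)
  have h₂ : (List.ofFn fun i : Fin c.length => cubeGen (σ.block c i)).prod = cubeGen σ := by
    have : ∀ i : Fin c.length, cubeGen (σ.block c i) = cubeGen σ := fun i => by
      have hi : (i : ℕ) = 0 := by omega
      have hb : c.blocksFun i = 1 := le_antisymm (c.blocksFun_le i) (c.one_le_blocksFun i)
      refine (pull_congr cubeGen hb σ _ id fun k hk _ => ?_).trans (congrArg cubeGen σ.pull_id)
      simp [hi]
    simp only [this, List.ofFn_const, List.prod_replicate, hl, pow_one]
  rw [nablaTerm, h₁, h₂, hl]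
  simp

/-- The coproduct on generators: the sum over all compositions, corrected by `1 ⊗ 1` for
`1`-simplices because `[σ] = cubeGen σ - 1` for them. -/
def nablaGen (n : ℕ) : NChain X b (n + 1) →ₗ[ℚ] cobarGr X b ᵍ⊗[ℚ] cobarGr X b :=
  NChain.lift (fun σ => (∑ c : Composition (n + 1), nablaTerm σ c) - if n = 0 then 1 else 0) <| by
    intro σ h
    rcases n with _ | n
    · have h0 : cubeGen σ = 1 := by rw [cubeGen, cobarGen_eq_zero h, add_zero]
      have hu : Fintype.card (Composition (0 + 1)) = 1 := by rw [composition_card]; rfl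
      rw [Finset.sum_congr rfl fun c _ => nablaTerm_one σ c, Finset.sum_const, Finset.card_univ, hu,
        h0, one_smul, if_pos rfl, sub_eq_zero]
      rfl
    · rw [Finset.sum_eq_zero fun c _ => nablaTerm_eq_zero h c]
      simp

/-- The coproduct `∇` of the cobar construction, obtained from the diagonal of the cubes of paths:
an algebra map to the graded tensor product. -/
def nabla (X : Type u) [TopologicalSpace X] (b : X) :
    Cobar X b →ₐ[ℚ] cobarGr X b ᵍ⊗[ℚ] cobarGr X b :=
  TA.lift nablaGen

lemma nabla_gen_zero (σ : PSimplex X b 1) : nabla X b (cubeGen σ) =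
    GradedTensorProduct.tmul ℚ (cubeGen σ) (cubeGen σ) := by
  have hu : Fintype.card (Composition (0 + 1)) = 1 := by rw [composition_card]; rfl
  rw [cubeGen, map_add, map_one, nabla, cobarGen, TA.lift_gen, nablaGen, NChain.lift_of, ← cobarGen,
    Finset.sum_congr rfl fun c _ => nablaTerm_one σ c, Finset.sum_const, Finset.card_univ, hu]
  simp [cubeGen]

/-- `π ⊗ π` for the projection `π` from the cobar construction to its homology in degree zero. -/
def cobarPiPi (X : Type u) [TopologicalSpace X] (b : X) :
    cobarGr X b ᵍ⊗[ℚ] cobarGr X b →ₐ[ℚ] H0Cobar X b ⊗[ℚ] H0Cobar X b :=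
  GradedTensorProduct.lift _ _
    (Algebra.TensorProduct.includeLeft.comp (cobarPi X b))
    (Algebra.TensorProduct.includeRight.comp (cobarPi X b)) <| by
      rintro i j ⟨x, hx⟩ ⟨y, hy⟩
      rcases i with _ | i
      · simp
      · simp [cobarPi_of_pos hx]

lemma cobarPiPi_tmul (x y : Cobar X b) :
    cobarPiPi X b (GradedTensorProduct.tmul ℚ x y) = cobarPi X b x ⊗ₜ[ℚ] cobarPi X b y := by
  simp [cobarPiPi]

lemma cobarPiPi_nabla_cubeGen (σ : PSimplex X b 1) :
    cobarPiPi X b (nabla X b (cubeGen σ)) = edge σ ⊗ₜ[ℚ] edge σ := by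
  rw [nabla_gen_zero, cobarPiPi_tmul, cobarPi_cubeGen]

lemma cobarPiPi_nabla_gen {n : ℕ} (σ : PSimplex X b (n + 2)) :
    cobarPiPi X b (nabla X b (cobarGen σ)) = 0 := by
  rw [nabla, cobarGen, TA.lift_gen, nablaGen, NChain.lift_of, if_neg (by omega), sub_zero, map_sum]
  refine Finset.sum_eq_zero fun c _ => ?_
  rw [nablaTerm, map_smul, cobarPiPi_tmul]
  have hlen : 0 < c.length := c.length_pos_iff.2 (by omega)
  by_cases h : 2 ≤ c.length
  · have := cubeGen_mem (σ.outer c)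
    obtain ⟨k, hk⟩ : ∃ k, c.length - 1 = k + 1 := ⟨c.length - 2, by omega⟩
    rw [hk] at this
    rw [cobarPi_of_pos this, TensorProduct.zero_tmul, smul_zero]
  · have hl : c.length = 1 := by omega
    have h0 : cobarPi X b (cubeGen (σ.block c ⟨0, hlen⟩)) = 0 := by
      have hm := cubeGen_mem (σ.block c ⟨0, hlen⟩)
      have hs := c.sizeUpTo_succ' ⟨0, hlen⟩
      simp only [c.sizeUpTo_zero, zero_add] at hs
      have := c.sizeUpTo_length
      rw [hl] at this
      have hk : c.blocksFun ⟨0, hlen⟩ - 1 = n + 1 := by omega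
      rw [hk] at hm
      exact cobarPi_of_pos hm
    rw [map_list_prod, List.prod_eq_zero, TensorProduct.tmul_zero, smul_zero]
    rw [List.mem_map]
    exact ⟨_, List.mem_ofFn.2 ⟨⟨0, hlen⟩, rfl⟩, h0⟩

/-- The coproduct on `H₀` induced by `∇`. -/
def H0Cobar.comul (X : Type u) [TopologicalSpace X] (b : X) :
    H0Cobar X b →ₐ[ℚ] H0Cobar X b ⊗[ℚ] H0Cobar X b :=
  H0.lift (((cobarPiPi X b).comp (nabla X b)).comp (cycles₀ (cobarGr X b) (cobarD X b)).val) <| by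
    intro z c _ hc
    have := comp_cobarD_eq_zero ((cobarPiPi X b).comp (nabla X b))
      (fun n σ => by rw [AlgHom.comp_apply]; exact cobarPiPi_nabla_gen σ) (fun σ => by
        rw [AlgHom.comp_apply, AlgHom.comp_apply, AlgHom.comp_apply, cobarPiPi_nabla_cubeGen,
          cobarPiPi_nabla_cubeGen, cobarPiPi_nabla_cubeGen, edge_face,
          Algebra.TensorProduct.tmul_mul_tmul]) c
    rw [AlgHom.comp_apply, Subalgebra.coe_val, ← hc]
    exact this

/-- The counit on `H₀` induced by the augmentation. -/
def H0Cobar.counit (X : Type u) [TopologicalSpace X] (b : X) : H0Cobar X b →ₐ[ℚ] ℚ :=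
  H0.lift ((cobarAug X b).comp (cycles₀ (cobarGr X b) (cobarD X b)).val) <| by
    intro z c _ hc
    have := comp_cobarD_eq_zero (cobarAug X b) (fun n σ => cobarAug_gen σ)
      (fun σ => by simp [cubeGen]) c
    rw [AlgHom.comp_apply, Subalgebra.coe_val, ← hc]
    exact this

lemma H0Cobar.comul_edge (σ : PSimplex X b 1) :
    H0Cobar.comul X b (edge σ) = edge σ ⊗ₜ[ℚ] edge σ :=
  cobarPiPi_nabla_cubeGen σ

lemma H0Cobar.counit_edge (σ : PSimplex X b 1) : H0Cobar.counit X b (edge σ) = 1 := by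
  have : cobarAug X b (cubeGen σ) = 1 := by simp [cubeGen]
  exact this

/-- The bialgebra structure on `H₀(Ω C_*(X, b; ℚ))` induced by the coproduct `∇` and the
augmentation of the cobar construction. -/
instance (X : Type u) [TopologicalSpace X] (b : X) : Bialgebra ℚ (H0Cobar X b) :=
  Bialgebra.ofAlgHom (H0Cobar.comul X b) (H0Cobar.counit X b)
    (H0Cobar.hom_ext fun σ => by simp [H0Cobar.comul_edge])
    (H0Cobar.hom_ext fun σ => by simp [H0Cobar.comul_edge, H0Cobar.counit_edge])
    (H0Cobar.hom_ext fun σ => by simp [H0Cobar.comul_edge, H0Cobar.counit_edge])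

end Coproduct

section Functoriality

variable {X Y Z : Type u} [TopologicalSpace X] [TopologicalSpace Y] [TopologicalSpace Z]
  {b : X} {c : Y} {e : Z}

/-- Composition of a pointed simplex with a pointed map. -/
def PSimplex.map (f : C(X, Y)) (hf : f b = c) {n : ℕ} (σ : PSimplex X b n) : PSimplex Y c n :=
  ⟨f.comp σ.1, fun i => by rw [ContinuousMap.comp_apply, σ.2 i, hf]⟩

lemma PSimplex.map_pull (f : C(X, Y)) (hf : f b = c) {m n : ℕ} (g : Fin (m + 1) → Fin (n + 1))
    (σ : PSimplex X b n) : (σ.pull g).map f hf = (σ.map f hf).pull g := rfl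

lemma PSimplex.IsDegenerate.map (f : C(X, Y)) (hf : f b = c) {n : ℕ} {σ : PSimplex X b n}
    (h : σ.IsDegenerate) : (σ.map f hf).IsDegenerate := by
  rcases n with _ | n
  · exact h.elim
  · obtain ⟨j, τ, rfl⟩ := h
    exact ⟨j, τ.map f hf, rfl⟩

/-- The map induced on pointed normalized chains. -/
def NChain.map (f : C(X, Y)) (hf : f b = c) (n : ℕ) : NChain X b n →ₗ[ℚ] NChain Y c n :=
  NChain.lift (fun σ => NChain.of (σ.map f hf)) fun _ h => NChain.of_eq_zero (h.map f hf)

/-- The map induced on cobar constructions. -/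
def cobarMap (f : C(X, Y)) (hf : f b = c) : Cobar X b →ₐ[ℚ] Cobar Y c :=
  TA.lift fun n => TA.gen (M := fun n => NChain Y c (n + 1)) n ∘ₗ NChain.map f hf (n + 1)

@[simp] lemma cobarMap_gen (f : C(X, Y)) (hf : f b = c) {n : ℕ} (σ : PSimplex X b (n + 1)) :
    cobarMap f hf (cobarGen σ) = cobarGen (σ.map f hf) := by
  simp [cobarMap, cobarGen, NChain.map]

@[simp] lemma cobarMap_cubeGen (f : C(X, Y)) (hf : f b = c) {n : ℕ} (σ : PSimplex X b n) :
    cobarMap f hf (cubeGen σ) = cubeGen (σ.map f hf) := by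
  rcases n with _ | _ | n <;> simp [cubeGen]

lemma cobarMap_mem (f : C(X, Y)) (hf : f b = c) {n : ℕ} {x : Cobar X b}
    (hx : x ∈ cobarGr X b n) : cobarMap f hf x ∈ cobarGr Y c n := by
  induction hx using Submodule.span_induction with
  | zero => simp
  | add x y hx hy ihx ihy => rw [map_add]; exact add_mem ihx ihy
  | smul r x hx ih => rw [map_smul]; exact Submodule.smul_mem _ _ ih
  | mem x hx =>
    obtain ⟨l, rfl, rfl⟩ := hx
    induction l with
    | nil => simpa using SetLike.one_mem_graded (cobarGr Y c)
    | cons p l ih =>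
      simp only [List.map_cons, List.prod_cons, List.sum_cons, map_mul]
      refine SetLike.mul_mem_graded ?_ ih
      rw [cobarMap, TA.lift_gen]
      exact TA.gen_mem _

lemma cobarMap_parity (f : C(X, Y)) (hf : f b = c) (x : Cobar X b) :
    cobarMap f hf (TA.parity x) = TA.parity (cobarMap f hf x) := by
  have : (cobarMap f hf).comp TA.parity = TA.parity.comp (cobarMap f hf) := by
    refine TA.hom_ext fun n x => ?_
    simp [TA.parity, cobarMap]
  exact AlgHom.congr_fun this x

lemma cobarMap_isDGHom (f : C(X, Y)) (hf : f b = c) :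
    IsDGHom (cobarGr X b) (cobarD X b) (cobarGr Y c) (cobarD Y c) (cobarMap f hf) where
  map_mem := cobarMap_mem f hf
  map_d x := by
    induction x using TA.induction_gen with
    | halg r => simp [cobarD]
    | hmul x y hx hy =>
      rw [cobarD, TA.deriv_mul, ← cobarD, map_add, map_mul, map_mul, hx, hy, map_mul, cobarD,
        TA.deriv_mul, cobarMap_parity]
    | hadd x y hx hy => rw [map_add, map_add, map_add, map_add, hx, hy]
    | hgen n x =>
      have : (cobarMap f hf).toLinearMap ∘ₗ cobarD X b ∘ₗ
          TA.gen (M := fun n => NChain X b (n + 1)) n =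
          cobarD Y c ∘ₗ (cobarMap f hf).toLinearMap ∘ₗ
            TA.gen (M := fun n => NChain X b (n + 1)) n := by
        refine NChain.hom_ext fun σ => ?_
        change cobarMap f hf (cobarD X b (cobarGen σ)) = cobarD Y c (cobarMap f hf (cobarGen σ))
        rw [cobarMap_gen]
        rcases n with _ | n
        · rw [cobarD_gen_zero, cobarD_gen_zero, map_zero]
        · rw [cobarD_gen_succ, cobarD_gen_succ]
          simp only [map_add, map_neg, map_sum, map_smul, map_mul, cobarMap_gen]
          rfl
      exact LinearMap.congr_fun this x

lemma H0map_edge (f : C(X, Y)) (hf : f b = c) (σ : PSimplex X b 1) :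
    (cobarMap_isDGHom f hf).H0map (edge σ) = edge (σ.map f hf) := by
  change H0.mk _ _ _ = H0.mk _ _ _
  congr 1
  exact Subtype.ext (cobarMap_cubeGen f hf σ)

/-- The bialgebra map `H₀(Ω C_*(X, b; ℚ)) → H₀(Ω C_*(Y, c; ℚ))` induced by a pointed map. -/
def H0Cobar.map (f : C(X, Y)) (hf : f b = c) : H0Cobar X b →ₐc[ℚ] H0Cobar Y c :=
  BialgHom.ofAlgHom (cobarMap_isDGHom f hf).H0map
    (H0Cobar.hom_ext fun σ => by
      rw [AlgHom.comp_apply, H0map_edge]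
      exact (H0Cobar.counit_edge _).trans (H0Cobar.counit_edge _).symm)
    (H0Cobar.hom_ext fun σ => by
      rw [AlgHom.comp_apply, AlgHom.comp_apply, H0map_edge]
      have h₁ : Bialgebra.comulAlgHom ℚ (H0Cobar X b) (edge σ) = _ := H0Cobar.comul_edge σ
      have h₂ : Bialgebra.comulAlgHom ℚ (H0Cobar Y c) (edge (σ.map f hf)) = _ :=
        H0Cobar.comul_edge (σ.map f hf)
      rw [h₁, h₂, Algebra.TensorProduct.map_tmul, H0map_edge])

end Functoriality

section Cubical

variable (M : Type u) [TopologicalSpace M]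

/-- Singular cubes `[0, 1]^n → M` of all dimensions. -/
structure Cube where
  /-- The dimension. -/
  dim : ℕ
  /-- The underlying map. -/
  toMap : C(Fin dim → unitInterval, M)

variable {M}

namespace Cube

/-- Evaluation of a cube on the first coordinates of a sequence. -/
def ev (a : Cube M) (y : ℕ → unitInterval) : M := a.toMap fun k => y k

/-- Extension of a point of a cube by zeros. -/
def ext₀ {n : ℕ} (x : Fin n → unitInterval) (k : ℕ) : unitInterval :=
  if h : k < n then x ⟨k, h⟩ else 0

lemma ext₀_val {n : ℕ} (x : Fin n → unitInterval) (k : Fin n) : ext₀ x k = x k := by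
  simp [ext₀]

lemma continuous_ext₀ {n : ℕ} (k : ℕ) :
    Continuous fun x : Fin n → unitInterval => ext₀ x k := by
  unfold ext₀
  split_ifs <;> fun_prop

lemma ext_ev {a c : Cube M} (h : a.dim = c.dim) (h' : ∀ y, a.ev y = c.ev y) : a = c := by
  obtain ⟨n, f⟩ := a
  obtain ⟨m, g⟩ := c
  obtain rfl : n = m := h
  congr 1
  ext x
  have := h' (ext₀ x)
  simpa [ev, ext₀_val] using this

lemma ev_congr (a : Cube M) {y y' : ℕ → unitInterval} (h : ∀ k < a.dim, y k = y' k) :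
    a.ev y = a.ev y' := by
  unfold ev
  congr 1
  funext k
  exact h k k.2

/-- Insertion of `ε` as the `i`-th coordinate. -/
def ins (i : ℕ) (ε : unitInterval) (y : ℕ → unitInterval) (k : ℕ) : unitInterval :=
  if k < i then y k else if k = i then ε else y (k - 1)

/-- The face of a cube on which the `i`-th coordinate is `ε` (for `i < dim`, counting from `0`). -/
def face (i : ℕ) (ε : unitInterval) (a : Cube M) : Cube M where
  dim := a.dim - 1
  toMap := a.toMap.comp ⟨fun x k => ins i ε (ext₀ x) k, by
    refine continuous_pi fun k => ?_
    unfold ins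
    split_ifs
    · exact continuous_ext₀ _
    · exact continuous_const
    · exact continuous_ext₀ _⟩

@[simp] lemma face_dim (i : ℕ) (ε : unitInterval) (a : Cube M) : (a.face i ε).dim = a.dim - 1 :=
  rfl

lemma face_ev {i : ℕ} (ε : unitInterval) (a : Cube M) (hi : i < a.dim) (y : ℕ → unitInterval) :
    (a.face i ε).ev y = a.ev (ins i ε y) := by
  change a.ev (ins i ε (ext₀ fun k : Fin (a.dim - 1) => y k)) = _
  refine ev_congr a fun k hk => ?_
  simp only [ins, ext₀]
  split_ifs <;> first | rfl | omega

lemma face_face {i j : ℕ} (ε η : unitInterval) (a : Cube M) (hij : i ≤ j) (hj : j + 1 < a.dim) :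
    (a.face i ε).face j η = (a.face (j + 1) η).face i ε := by
  refine ext_ev rfl fun y => ?_
  rw [face_ev _ _ (by simp; omega), face_ev _ _ (by omega), face_ev _ _ (by simp; omega),
    face_ev _ _ (by omega)]
  congr 1
  funext k
  simp only [ins]
  split_ifs <;> first | rfl | omega

/-- A cube is degenerate if it does not depend on one of its coordinates. -/
def IsDegenerate (a : Cube M) : Prop :=
  ∃ i : Fin a.dim, ∀ x x', (∀ k, k ≠ i → x k = x' k) → a.toMap x = a.toMap x'

lemma isDegenerate_iff (a : Cube M) : a.IsDegenerate ↔
    ∃ i < a.dim, ∀ y y', (∀ k, k ≠ i → y k = y' k) → a.ev y = a.ev y' := by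
  constructor
  · rintro ⟨i, h⟩
    exact ⟨i, i.2, fun y y' hy => h _ _ fun k hk => hy k fun h' => hk (Fin.ext h')⟩
  · rintro ⟨i, hi, h⟩
    refine ⟨⟨i, hi⟩, fun x x' hx => ?_⟩
    have := h (ext₀ x) (ext₀ x') fun k hk => by
      unfold ext₀
      split_ifs with h'
      · exact hx _ fun h'' => hk (congrArg Fin.val h'')
      · rfl
    simpa [ev, ext₀_val] using this

variable [Monoid M] [ContinuousMul M]

instance : Monoid (Cube M) where
  mul a c := ⟨a.dim + c.dim,
    ⟨fun x => a.toMap (fun k => x (Fin.castAdd c.dim k)) * c.toMap (fun k => x (Fin.natAdd a.dim k)),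
      by fun_prop⟩⟩
  one := ⟨0, ContinuousMap.const _ 1⟩
  mul_assoc a c e := ext_ev (add_assoc _ _ _) fun y => by
    refine (mul_assoc (a.ev y) (c.ev fun k => y (a.dim + k))
      (e.ev fun k => y (a.dim + c.dim + k))).trans ?_
    simp only [add_assoc]
    rfl
  one_mul a := ext_ev (zero_add _) fun y => by
    refine (one_mul (a.ev fun k => y (0 + k))).trans ?_
    simp only [zero_add]
  mul_one a := ext_ev (add_zero _) fun y => mul_one (a.ev y)

lemma mul_dim (a c : Cube M) : (a * c).dim = a.dim + c.dim := rfl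

lemma one_dim : (1 : Cube M).dim = 0 := rfl

lemma mul_ev (a c : Cube M) (y : ℕ → unitInterval) :
    (a * c).ev y = a.ev y * c.ev fun k => y (a.dim + k) := rfl

lemma face_mul_left {i : ℕ} (ε : unitInterval) (a c : Cube M) (hi : i < a.dim) :
    (a * c).face i ε = a.face i ε * c := by
  refine ext_ev (by simp only [face_dim, mul_dim]; omega) fun y => ?_
  rw [face_ev _ _ (by rw [mul_dim]; omega), mul_ev, mul_ev, face_ev _ _ hi]
  congr 2
  funext k
  simp only [ins, face_dim]
  rw [if_neg (by omega), if_neg (by omega)]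
  congr 1
  omega

lemma face_mul_right {i : ℕ} (ε : unitInterval) (a c : Cube M) (hi : i < c.dim) :
    (a * c).face (a.dim + i) ε = a * c.face i ε := by
  refine ext_ev (by simp only [face_dim, mul_dim]; omega) fun y => ?_
  rw [face_ev _ _ (by rw [mul_dim]; omega), mul_ev, mul_ev, face_ev _ _ hi]
  congr 1
  · refine ev_congr a fun k hk => ?_
    simp only [ins]
    rw [if_pos (by omega)]
  · congr 1
    funext k
    simp only [ins]
    split_ifs <;> first | rfl | omega | (congr 1; omega)

lemma IsDegenerate.mul_left {a : Cube M} (h : a.IsDegenerate) (c : Cube M) :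
    (c * a).IsDegenerate := by
  rw [isDegenerate_iff] at h ⊢
  obtain ⟨i, hi, h⟩ := h
  refine ⟨c.dim + i, by rw [mul_dim]; omega, fun y y' hy => ?_⟩
  rw [mul_ev, mul_ev]
  congr 1
  · exact ev_congr c fun k hk => hy k (by omega)
  · exact h _ _ fun k hk => hy _ (by omega)

lemma IsDegenerate.mul_right {a : Cube M} (h : a.IsDegenerate) (c : Cube M) :
    (a * c).IsDegenerate := by
  rw [isDegenerate_iff] at h ⊢
  obtain ⟨i, hi, h⟩ := h
  refine ⟨i, by rw [mul_dim]; omega, fun y y' hy => ?_⟩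
  rw [mul_ev, mul_ev, h y y' hy]
  congr 2
  funext k
  exact hy _ (by omega)

end Cube

variable (M) [Monoid M] [ContinuousMul M]

lemma single_eq_smul {G : Type*} (g : G) (q : ℚ) : (MonoidAlgebra.single g q : MonoidAlgebra ℚ G) =
    q • MonoidAlgebra.single g 1 := by
  rw [MonoidAlgebra.smul_single, smul_eq_mul, mul_one]

/-- The two-sided ideal of degenerate cubical chains: the span of the degenerate cubes. -/
def degenerateCubes : Ideal (MonoidAlgebra ℚ (Cube M)) where
  carrier := Submodule.span ℚ
    ((fun a : Cube M => MonoidAlgebra.single a (1 : ℚ)) '' {a | a.IsDegenerate})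
  add_mem' := add_mem
  zero_mem' := zero_mem _
  smul_mem' r x hx := by
    simp only [SetLike.mem_coe, smul_eq_mul] at hx ⊢
    induction hx using Submodule.span_induction with
    | zero => simp
    | add x y hx hy ihx ihy => rw [mul_add]; exact add_mem ihx ihy
    | smul s x hx ih => rw [mul_smul_comm]; exact Submodule.smul_mem _ _ ih
    | mem x hx =>
      obtain ⟨a, ha, rfl⟩ := hx
      induction r using MonoidAlgebra.induction_linear with
      | zero => simp
      | add r s hr hs => rw [add_mul]; exact add_mem hr hs
      | single c q =>
        rw [MonoidAlgebra.single_mul_single, mul_one, single_eq_smul]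
        exact Submodule.smul_mem _ _ (Submodule.subset_span ⟨_, ha.mul_left c, rfl⟩)

lemma mem_degenerateCubes {x : MonoidAlgebra ℚ (Cube M)} : x ∈ degenerateCubes M ↔
    x ∈ Submodule.span ℚ
      ((fun a : Cube M => MonoidAlgebra.single a (1 : ℚ)) '' {a | a.IsDegenerate}) := Iff.rfl

instance : (degenerateCubes M).IsTwoSided where
  mul_mem_of_left {x} r hx := by
    rw [mem_degenerateCubes] at hx ⊢
    induction hx using Submodule.span_induction with
    | zero => simp
    | add x y hx hy ihx ihy => rw [add_mul]; exact add_mem ihx ihy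
    | smul s x hx ih => rw [smul_mul_assoc]; exact Submodule.smul_mem _ _ ih
    | mem x hx =>
      obtain ⟨a, ha, rfl⟩ := hx
      induction r using MonoidAlgebra.induction_linear with
      | zero => simp
      | add r s hr hs => rw [mul_add]; exact add_mem hr hs
      | single c q =>
        rw [MonoidAlgebra.single_mul_single, one_mul, single_eq_smul]
        exact Submodule.smul_mem _ _ (Submodule.subset_span ⟨_, ha.mul_right c, rfl⟩)

/-- The algebra `C^□_*(M; ℚ)` of normalized singular cubical chains on a topological monoid. -/
def CubeChains : Type u := MonoidAlgebra ℚ (Cube M) ⧸ degenerateCubes M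

instance : Ring (CubeChains M) :=
  inferInstanceAs (Ring (MonoidAlgebra ℚ (Cube M) ⧸ degenerateCubes M))
instance : Algebra ℚ (CubeChains M) :=
  inferInstanceAs (Algebra ℚ (MonoidAlgebra ℚ (Cube M) ⧸ degenerateCubes M))

/-- The projection from cubical chains to normalized ones. -/
def CubeChains.proj : MonoidAlgebra ℚ (Cube M) →ₐ[ℚ] CubeChains M :=
  Ideal.Quotient.mkₐ ℚ (degenerateCubes M)

lemma CubeChains.proj_surjective : Function.Surjective (CubeChains.proj M) :=
  Ideal.Quotient.mkₐ_surjective ℚ (degenerateCubes M)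

variable {M}

/-- The class of a cube. -/
def CubeChains.of (a : Cube M) : CubeChains M := CubeChains.proj M (MonoidAlgebra.single a 1)

lemma CubeChains.of_eq_zero {a : Cube M} (h : a.IsDegenerate) : CubeChains.of a = 0 :=
  Ideal.Quotient.eq_zero_iff_mem.2 ((mem_degenerateCubes M).2 (Submodule.subset_span ⟨a, h, rfl⟩))

lemma CubeChains.of_mul (a c : Cube M) :
    CubeChains.of (a * c) = CubeChains.of a * CubeChains.of c := by
  rw [CubeChains.of, CubeChains.of, CubeChains.of, ← map_mul, MonoidAlgebra.single_mul_single,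
    mul_one]

lemma CubeChains.of_one : CubeChains.of (1 : Cube M) = 1 := by
  rw [CubeChains.of, ← MonoidAlgebra.one_def, map_one]

lemma CubeChains.induction {C : CubeChains M → Prop} (h0 : C 0)
    (hadd : ∀ x y, C x → C y → C (x + y)) (hsmul : ∀ (r : ℚ) x, C x → C (r • x))
    (hof : ∀ a, C (CubeChains.of a)) (x : CubeChains M) : C x := by
  obtain ⟨x, rfl⟩ := CubeChains.proj_surjective M x
  induction x using MonoidAlgebra.induction_linear with
  | zero => simpa using h0
  | add r s hr hs => rw [map_add]; exact hadd _ _ hr hs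
  | single c q =>
    rw [single_eq_smul, map_smul]
    exact hsmul _ _ (hof c)

/-- Linear extension of a function on cubes which vanishes on degenerate ones. -/
def CubeChains.lift {W : Type*} [AddCommGroup W] [Module ℚ W] (f : Cube M → W)
    (hf : ∀ a, a.IsDegenerate → f a = 0) : CubeChains M →ₗ[ℚ] W :=
  ((degenerateCubes M).restrictScalars ℚ).liftQ
    (Finsupp.linearCombination ℚ f ∘ₗ (MonoidAlgebra.coeffLinearEquiv ℚ).toLinearMap) (by
      have h : (degenerateCubes M).restrictScalars ℚ = Submodule.span ℚ
        ((fun a : Cube M => MonoidAlgebra.single a (1 : ℚ)) '' {a | a.IsDegenerate}) := rfl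
      rw [h, Submodule.span_le]
      rintro _ ⟨a, ha, rfl⟩
      simpa using hf a ha) ∘ₗ
    (Submodule.Quotient.restrictScalarsEquiv ℚ (degenerateCubes M)).symm.toLinearMap

@[simp] lemma CubeChains.lift_of {W : Type*} [AddCommGroup W] [Module ℚ W] (f : Cube M → W)
    (hf : ∀ a, a.IsDegenerate → f a = 0) (a : Cube M) :
    CubeChains.lift f hf (CubeChains.of a) = f a := by
  have : CubeChains.lift f hf (CubeChains.of a) = Finsupp.linearCombination ℚ f
    ((MonoidAlgebra.coeffLinearEquiv ℚ) (MonoidAlgebra.single a (1 : ℚ))) := rfl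
  rw [this]
  simp

/-- The chains of degree `n`: the span of the `n`-cubes. -/
def cubeGr (M : Type u) [TopologicalSpace M] [Monoid M] [ContinuousMul M] (n : ℕ) :
    Submodule ℚ (CubeChains M) :=
  Submodule.span ℚ (CubeChains.of '' {a | a.dim = n})

lemma CubeChains.of_mem (a : Cube M) : CubeChains.of a ∈ cubeGr M a.dim :=
  Submodule.subset_span ⟨a, rfl, rfl⟩

instance : SetLike.GradedMonoid (cubeGr M) where
  one_mem := Submodule.subset_span ⟨1, rfl, CubeChains.of_one⟩
  mul_mem := by
    intro i j x y hx hy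
    have : x * y ∈ cubeGr M i * cubeGr M j := Submodule.mul_mem_mul hx hy
    rw [cubeGr, cubeGr, Submodule.span_mul_span] at this
    refine Submodule.span_mono ?_ this
    rintro _ ⟨_, ⟨a, rfl, rfl⟩, _, ⟨c, rfl, rfl⟩, rfl⟩
    exact ⟨a * c, rfl, CubeChains.of_mul a c⟩

/-- Auxiliary: the decomposition into homogeneous components, on unnormalized chains. -/
def cubeDecomp₀ : MonoidAlgebra ℚ (Cube M) →ₐ[ℚ] ⨁ n, cubeGr M n :=
  MonoidAlgebra.lift ℚ _ (Cube M)
    { toFun := fun a => DirectSum.of (fun n => cubeGr M n) a.dim ⟨CubeChains.of a, CubeChains.of_mem a⟩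
      map_one' := DirectSum.of_eq_of_gradedMonoid_eq
        (Sigma.subtype_ext rfl CubeChains.of_one)
      map_mul' := fun a c => by
        rw [DirectSum.of_mul_of]
        exact DirectSum.of_eq_of_gradedMonoid_eq (Sigma.subtype_ext rfl (CubeChains.of_mul a c)) }

/-- Auxiliary: the decomposition into homogeneous components. -/
def cubeDecomp : CubeChains M →ₐ[ℚ] ⨁ n, cubeGr M n :=
  Ideal.Quotient.liftₐ (degenerateCubes M) cubeDecomp₀ fun x hx => by
    rw [mem_degenerateCubes] at hx
    induction hx using Submodule.span_induction with
    | zero => simp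
    | add x y hx hy ihx ihy => rw [map_add, ihx, ihy, add_zero]
    | smul s x hx ih => rw [map_smul, ih, smul_zero]
    | mem x hx =>
      obtain ⟨a, ha, rfl⟩ := hx
      simp only [cubeDecomp₀, MonoidAlgebra.lift_single, one_smul]
      change DirectSum.of (fun n => cubeGr M n) a.dim ⟨CubeChains.of a, _⟩ = 0
      simp only [CubeChains.of_eq_zero ha]
      exact map_zero (DirectSum.of (fun n => cubeGr M n) a.dim)

lemma cubeDecomp_of (a : Cube M) : cubeDecomp (CubeChains.of a) =
    DirectSum.of (fun n => cubeGr M n) a.dim ⟨CubeChains.of a, CubeChains.of_mem a⟩ := by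
  have : cubeDecomp (CubeChains.of a) = cubeDecomp₀ (MonoidAlgebra.single a 1) := rfl
  rw [this, cubeDecomp₀, MonoidAlgebra.lift_single, one_smul]
  rfl

instance : GradedAlgebra (cubeGr M) :=
  GradedAlgebra.ofAlgHom (cubeGr M) cubeDecomp
    (by
      ext x
      induction x using CubeChains.induction with
      | h0 => simp
      | hadd x y hx hy => rw [map_add, map_add, hx, hy]
      | hsmul r x hx => rw [map_smul, map_smul, hx]
      | hof a =>
        rw [AlgHom.comp_apply, cubeDecomp_of, DirectSum.coeAlgHom_of]
        rfl)
    (by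
      rintro i ⟨x, hx⟩
      induction hx using Submodule.span_induction with
      | zero => simp only [map_zero]; exact (map_zero (DirectSum.of (fun i => cubeGr M i) i)).symm
      | add x y hx hy ihx ihy =>
        simp only [map_add, ihx, ihy]
        exact (map_add (DirectSum.of (fun i => cubeGr M i) i) _ _).symm
      | smul r x hx ih =>
        simp only [map_smul, ih]
        exact (map_smul (DirectSum.lof ℚ ℕ (fun i => cubeGr M i) i) _ _).symm
      | mem x hx =>
        obtain ⟨a, rfl, rfl⟩ := hx
        exact cubeDecomp_of a)

/-- The boundary `∑ (-1)^i (∂ᵢ¹ - ∂ᵢ⁰)` of a cube. -/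
def cubeBd (a : Cube M) : CubeChains M :=
  ∑ i ∈ Finset.range a.dim, (-1 : ℚ) ^ i •
    (CubeChains.of (a.face i 1) - CubeChains.of (a.face i 0))

lemma cubeBd_eq_zero {a : Cube M} (h : a.IsDegenerate) : cubeBd a = 0 := by
  rw [Cube.isDegenerate_iff] at h
  obtain ⟨i, hi, h⟩ := h
  refine Finset.sum_eq_zero fun j hj => ?_
  rw [Finset.mem_range] at hj
  rcases lt_trichotomy i j with hij | rfl | hij
  · have : ∀ ε, CubeChains.of (a.face j ε) = 0 := fun ε =>
      CubeChains.of_eq_zero <| (Cube.isDegenerate_iff _).2 ⟨i, by rw [Cube.face_dim]; omega, by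
        intro y y' hy
        rw [Cube.face_ev _ _ hj, Cube.face_ev _ _ hj]
        refine h _ _ fun k hk => ?_
        simp only [Cube.ins]
        split_ifs <;> first | rfl | exact hy _ (by omega)⟩
    rw [this, this, sub_zero, smul_zero]
  · have : a.face i 1 = a.face i 0 := Cube.ext_ev rfl fun y => by
      rw [Cube.face_ev _ _ hj, Cube.face_ev _ _ hj]
      refine h _ _ fun k hk => ?_
      simp only [Cube.ins, if_neg hk]
    rw [this, sub_self, smul_zero]
  · have : ∀ ε, CubeChains.of (a.face j ε) = 0 := fun ε =>
      CubeChains.of_eq_zero <| (Cube.isDegenerate_iff _).2 ⟨i - 1, by rw [Cube.face_dim]; omega, by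
        intro y y' hy
        rw [Cube.face_ev _ _ hj, Cube.face_ev _ _ hj]
        refine h _ _ fun k hk => ?_
        simp only [Cube.ins]
        split_ifs <;> first | rfl | exact hy _ (by omega)⟩
    rw [this, this, sub_zero, smul_zero]

/-- The differential of the normalized cubical chains. -/
def cubeD (M : Type u) [TopologicalSpace M] [Monoid M] [ContinuousMul M] :
    CubeChains M →ₗ[ℚ] CubeChains M :=
  CubeChains.lift cubeBd fun _ h => cubeBd_eq_zero h

lemma cubeD_of (a : Cube M) : cubeD M (CubeChains.of a) = cubeBd a := CubeChains.lift_of _ _ a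

lemma cubeBd_mul (a c : Cube M) : cubeBd (a * c) =
    cubeBd a * CubeChains.of c + (-1 : ℚ) ^ a.dim • (CubeChains.of a * cubeBd c) := by
  rw [cubeBd, Cube.mul_dim, Finset.sum_range_add]
  congr 1
  · rw [cubeBd, Finset.sum_mul]
    refine Finset.sum_congr rfl fun i hi => ?_
    rw [Finset.mem_range] at hi
    rw [Cube.face_mul_left _ _ _ hi, Cube.face_mul_left _ _ _ hi, CubeChains.of_mul,
      CubeChains.of_mul, smul_mul_assoc, sub_mul]
  · rw [cubeBd, Finset.mul_sum, Finset.smul_sum]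
    refine Finset.sum_congr rfl fun i hi => ?_
    rw [Finset.mem_range] at hi
    rw [Cube.face_mul_right _ _ _ hi, Cube.face_mul_right _ _ _ hi, CubeChains.of_mul,
      CubeChains.of_mul, mul_smul_comm, mul_sub, pow_add, mul_smul]

lemma cubeD_cubeBd (a : Cube M) : cubeD M (cubeBd a) = 0 := by
  rcases hn : a.dim with _ | P
  · simp [cubeBd, hn]
  rw [← sum_sum_alternating P (fun i j =>
    CubeChains.of ((a.face i 1).face j 1) - CubeChains.of ((a.face i 1).face j 0) -
      (CubeChains.of ((a.face i 0).face j 1) - CubeChains.of ((a.face i 0).face j 0)))]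
  · rw [cubeBd, hn, map_sum]
    refine Finset.sum_congr rfl fun i _ => ?_
    rw [map_smul, map_sub, cubeD_of, cubeD_of, cubeBd, cubeBd, Cube.face_dim, Cube.face_dim, hn,
      Nat.add_sub_cancel, ← Finset.sum_sub_distrib, Finset.smul_sum]
    refine Finset.sum_congr rfl fun j _ => ?_
    rw [pow_add, mul_smul, ← smul_sub]
  · intro i j hij hj
    rw [Cube.face_face _ _ _ hij (by omega), Cube.face_face _ _ _ hij (by omega),
      Cube.face_face _ _ _ hij (by omega), Cube.face_face _ _ _ hij (by omega)]
    abel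

/-- The normalized cubical chains on a topological monoid are a differential graded algebra. -/
instance : IsDGAlgebra (cubeGr M) (cubeD M) where
  d_mem {n x} h := by
    induction h using Submodule.span_induction with
    | zero => simp
    | add x y hx hy ihx ihy => rw [map_add]; exact add_mem ihx ihy
    | smul r x hx ih => rw [map_smul]; exact Submodule.smul_mem _ _ ih
    | mem x hx =>
      obtain ⟨a, ha, rfl⟩ := hx
      rw [cubeD_of]
      have : ∀ i ε, CubeChains.of (a.face i ε) ∈ cubeGr M n := fun i ε =>
        Submodule.subset_span ⟨_, by
          rw [Set.mem_ofPred_eq] at ha ⊢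
          rw [Cube.face_dim, ha, Nat.add_sub_cancel], rfl⟩
      exact sum_mem fun i _ => Submodule.smul_mem _ _ (sub_mem (this _ _) (this _ _))
  d_zero {x} h := by
    induction h using Submodule.span_induction with
    | zero => simp
    | add x y hx hy ihx ihy => rw [map_add, ihx, ihy, add_zero]
    | smul r x hx ih => rw [map_smul, ih, smul_zero]
    | mem x hx =>
      obtain ⟨a, ha, rfl⟩ := hx
      rw [Set.mem_ofPred_eq] at ha
      rw [cubeD_of, cubeBd, ha, Finset.sum_range_zero]
  leibniz {n x} y h := by
    induction h using Submodule.span_induction with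
    | zero => simp
    | add x x' hx hx' ihx ihx' => 
      rw [add_mul, map_add, ihx, ihx', map_add, add_mul, add_mul, smul_add]
      abel
    | smul r x hx ih =>
      rw [smul_mul_assoc, map_smul, ih, map_smul, smul_mul_assoc, smul_mul_assoc, smul_add,
        smul_comm r]
    | mem x hx =>
      obtain ⟨a, rfl, rfl⟩ := hx
      induction y using CubeChains.induction with
      | h0 => simp
      | hadd y y' hy hy' =>
        rw [mul_add, map_add, hy, hy', map_add, mul_add, mul_add, smul_add]
        abel
      | hsmul r y hy =>
        rw [mul_smul_comm, map_smul, hy, map_smul, mul_smul_comm, mul_smul_comm, smul_add,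
          smul_comm r]
      | hof c => rw [← CubeChains.of_mul, cubeD_of, cubeD_of, cubeD_of, cubeBd_mul]
  d_d x := by
    induction x using CubeChains.induction with
    | h0 => simp
    | hadd x y hx hy => rw [map_add, map_add, hx, hy, add_zero]
    | hsmul r x hx => rw [map_smul, map_smul, hx, smul_zero]
    | hof a => rw [cubeD_of, cubeD_cubeBd]

/-- The `0`-cube given by a point. -/
def Cube.point (x : M) : Cube M := ⟨0, ContinuousMap.const _ x⟩

/-- The class in `H₀` of a point. -/
def pointClass (x : M) : H0 (cubeGr M) (cubeD M) :=
  H0.mk (cubeGr M) (cubeD M)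
    (cycle (cubeGr M) (cubeD M) (CubeChains.of (Cube.point x)) (CubeChains.of_mem (Cube.point x)))

lemma pointClass_one : pointClass (1 : M) = 1 := by
  rw [pointClass, ← map_one (H0.mk (cubeGr M) (cubeD M))]
  exact congrArg _ (Subtype.ext CubeChains.of_one)

lemma pointClass_mul (x y : M) : pointClass (x * y) = pointClass x * pointClass y := by
  rw [pointClass, pointClass, pointClass, ← map_mul]
  congr 1
  refine Subtype.ext ?_
  change CubeChains.of _ = CubeChains.of _ * CubeChains.of _
  rw [← CubeChains.of_mul]
  rfl

/-- The `1`-cube given by a path. -/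
def Cube.path (p : C(unitInterval, M)) : Cube M :=
  ⟨1, p.comp ⟨fun x => x 0, continuous_apply 0⟩⟩

lemma Cube.path_face (p : C(unitInterval, M)) (ε : unitInterval) :
    (Cube.path p).face 0 ε = Cube.point (p ε) :=
  Cube.ext_ev rfl fun y => by
    rw [Cube.face_ev _ _ (by exact one_pos)]
    change p (Cube.ins 0 ε y 0) = p ε
    simp [Cube.ins]

lemma pointClass_eq_of_path (p : C(unitInterval, M)) :
    pointClass (p 0) = pointClass (p 1) := by
  rw [eq_comm, ← sub_eq_zero, pointClass, pointClass, ← map_sub, H0.mk_eq_zero]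
  have hm : CubeChains.of (Cube.path p) ∈ cubeGr M 1 := CubeChains.of_mem (Cube.path p)
  refine ⟨CubeChains.of (Cube.path p), hm, ?_⟩
  have h : cubeBd (Cube.path p) = ∑ i ∈ Finset.range 1, (-1 : ℚ) ^ i •
    (CubeChains.of ((Cube.path p).face i 1) - CubeChains.of ((Cube.path p).face i 0)) := rfl
  rw [cubeD_of, h, Finset.sum_range_one, pow_zero, one_smul, Cube.path_face, Cube.path_face]
  rfl

end Cubical

section Moore

variable {X : Type u} [TopologicalSpace X] {b : X}

/-- The space `Ω_b X` of Moore loops: pairs of a map `γ : [0, ∞) → X` and a length `r ≥ 0` such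
that `γ 0 = b` and `γ t = b` for `t ≥ r`, with the topology of `C([0, ∞), X) × [0, ∞)`. -/
def MooreLoop (X : Type u) [TopologicalSpace X] (b : X) : Type u :=
  {p : C(ℝ≥0, X) × ℝ≥0 // p.1 0 = b ∧ ∀ t, p.2 ≤ t → p.1 t = b}

namespace MooreLoop

instance : TopologicalSpace (MooreLoop X b) :=
  inferInstanceAs (TopologicalSpace {p : C(ℝ≥0, X) × ℝ≥0 // p.1 0 = b ∧ ∀ t, p.2 ≤ t → p.1 t = b})

/-- The underlying map of a Moore loop. -/
def toMap (γ : MooreLoop X b) : C(ℝ≥0, X) := γ.1.1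

/-- The length of a Moore loop. -/
def length (γ : MooreLoop X b) : ℝ≥0 := γ.1.2

lemma toMap_zero (γ : MooreLoop X b) : γ.toMap 0 = b := γ.2.1

lemma toMap_of_length_le (γ : MooreLoop X b) {t : ℝ≥0} (h : γ.length ≤ t) : γ.toMap t = b :=
  γ.2.2 t h

lemma ext {γ δ : MooreLoop X b} (h₁ : ∀ t, γ.toMap t = δ.toMap t) (h₂ : γ.length = δ.length) :
    γ = δ :=
  Subtype.ext (Prod.ext (ContinuousMap.ext h₁) h₂)

lemma continuous_toMap : Continuous (toMap : MooreLoop X b → C(ℝ≥0, X)) :=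
  continuous_fst.comp continuous_subtype_val

lemma continuous_length : Continuous (length : MooreLoop X b → ℝ≥0) :=
  continuous_snd.comp continuous_subtype_val

/-- A family of Moore loops is continuous if its uncurried map and its lengths are. -/
lemma continuous_mk {T : Type*} [TopologicalSpace T] (f : T → MooreLoop X b)
    (h₁ : Continuous fun p : T × ℝ≥0 => (f p.1).toMap p.2)
    (h₂ : Continuous fun t => (f t).length) : Continuous f :=
  Continuous.subtype_mk
    ((ContinuousMap.continuous_of_continuous_uncurry (fun t => (f t).toMap) h₁).prodMk h₂) _

/-- The underlying function of the concatenation of Moore loops. -/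
def mulFun (γ δ : MooreLoop X b) (t : ℝ≥0) : X :=
  if t ≤ γ.length then γ.toMap t else δ.toMap (t - γ.length)

lemma continuous_mulFun {T : Type*} [TopologicalSpace T] {f g : T → MooreLoop X b} {s : T → ℝ≥0}
    (hf : Continuous f) (hg : Continuous g) (hs : Continuous s) :
    Continuous fun t => mulFun (f t) (g t) (s t) := by
  unfold mulFun
  have hf₁ := continuous_toMap.comp hf
  have hf₂ := continuous_length.comp hf
  have hg₁ := continuous_toMap.comp hg
  refine Continuous.if_le (hf₁.eval hs) (hg₁.eval (hs.sub hf₂)) hs hf₂ fun t ht => ?_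
  have ht' : s t = (f t).length := ht
  rw [ht', tsub_self, toMap_zero, toMap_of_length_le _ le_rfl]

/-- Concatenation of Moore loops: first `γ`, then `δ`; the lengths add up. -/
instance : Mul (MooreLoop X b) where
  mul γ δ := ⟨(⟨mulFun γ δ, continuous_mulFun continuous_const continuous_const continuous_id⟩,
    γ.length + δ.length), by
      constructor
      · simp only [ContinuousMap.coe_mk, mulFun, zero_le, if_true, toMap_zero]
      · intro t ht
        simp only [ContinuousMap.coe_mk, mulFun] at ht ⊢
        split_ifs with h
        · have : γ.length = t := le_antisymm (le_trans le_self_add ht) h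
          exact toMap_of_length_le _ this.le
        · exact toMap_of_length_le _ (le_tsub_of_add_le_left ht)⟩

lemma mul_toMap (γ δ : MooreLoop X b) (t : ℝ≥0) : (γ * δ).toMap t =
    if t ≤ γ.length then γ.toMap t else δ.toMap (t - γ.length) := rfl

lemma mul_length (γ δ : MooreLoop X b) : (γ * δ).length = γ.length + δ.length := rfl

/-- The loop of length `0`. -/
instance : One (MooreLoop X b) where
  one := ⟨(ContinuousMap.const _ b, 0), by simp⟩

lemma one_toMap (t : ℝ≥0) : (1 : MooreLoop X b).toMap t = b := rfl

lemma one_length : (1 : MooreLoop X b).length = 0 := rfl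

/-- The monoid of Moore loops. -/
instance : Monoid (MooreLoop X b) where
  mul_assoc γ δ ε := ext (fun t => by
    rw [mul_toMap, mul_toMap, mul_toMap, mul_toMap]
    by_cases h₁ : t ≤ γ.length
    · rw [if_pos h₁, if_pos h₁, if_pos (by rw [mul_length]; exact le_trans h₁ le_self_add)]
    · rw [if_neg h₁, if_neg h₁]
      have : t ≤ (γ * δ).length ↔ t - γ.length ≤ δ.length := by
        rw [mul_length, tsub_le_iff_left]
      by_cases h₂ : t - γ.length ≤ δ.length
      · rw [if_pos h₂, if_pos (this.2 h₂)]
      · rw [if_neg h₂, if_neg (mt this.1 h₂), mul_length, tsub_add_eq_tsub_tsub]) (add_assoc _ _ _)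
  one_mul γ := ext (fun t => by
    simp only [mul_toMap, one_length, one_toMap, tsub_zero]
    split_ifs with h
    · rw [le_antisymm h bot_le, toMap_zero]
    · rfl) (zero_add _)
  mul_one γ := ext (fun t => by
    simp only [mul_toMap, one_toMap]
    split_ifs with h
    · rfl
    · exact (toMap_of_length_le _ (not_le.1 h).le).symm) (add_zero _)

instance : ContinuousMul (MooreLoop X b) where
  continuous_mul := continuous_mk _
    (continuous_mulFun (continuous_fst.comp continuous_fst) (continuous_snd.comp continuous_fst)
      continuous_snd)
    ((continuous_length.comp continuous_fst).add (continuous_length.comp continuous_snd))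

/-- The path `t ↦ γ (r t)` on `[0, 1]` given by a Moore loop `γ` of length `r`. -/
def toPath (γ : MooreLoop X b) : Path b b where
  toFun t := γ.toMap (γ.length * Real.toNNReal t)
  continuous_toFun := by fun_prop
  source' := by simp [toMap_zero]
  target' := by simp [toMap_of_length_le]

end MooreLoop

/-- The fundamental group in which `p * q` is the class of the path `p` followed by `q`; the
multiplication of `FundamentalGroup X b` is in the opposite order. -/
abbrev Pi1 (X : Type u) [TopologicalSpace X] (b : X) : Type u := (FundamentalGroup X b)ᵐᵒᵖ

/-- The class of a loop in the fundamental group. -/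
def Pi1.mk (p : Path b b) : Pi1 X b :=
  MulOpposite.op (FundamentalGroup.fromPath (Path.Homotopic.Quotient.mk p))

lemma Pi1.mk_trans (p q : Path b b) : Pi1.mk (p.trans q) = Pi1.mk p * Pi1.mk q := rfl

/-- The homomorphism of fundamental groups induced by a pointed map. -/
def Pi1.map {Y : Type u} [TopologicalSpace Y] {c : Y} (f : C(X, Y)) (hf : f b = c) :
    Pi1 X b →* Pi1 Y c :=
  (FundamentalGroup.mapOfEq f hf).op

/-- The standard path from the vertex `0` to the vertex `1` of the `1`-simplex. -/
def edgePoint (t : ℝ≥0) : stdSimplex ℝ (Fin 2) :=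
  ⟨![1 - min (t : ℝ) 1, min (t : ℝ) 1], by
    constructor
    · intro i
      fin_cases i <;> simp
    · simp [Fin.sum_univ_two]⟩

lemma continuous_edgePoint : Continuous edgePoint := by
  refine Continuous.subtype_mk (continuous_pi fun i => ?_) _
  fin_cases i <;> simp <;> fun_prop

lemma edgePoint_zero : edgePoint 0 = stdSimplex.vertex 0 := by
  ext i
  fin_cases i <;> simp [edgePoint] <;> rfl

lemma edgePoint_of_le {t : ℝ≥0} (ht : 1 ≤ t) : edgePoint t = stdSimplex.vertex 1 := by
  have ht : (1 : ℝ) ≤ t := ht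
  ext i
  fin_cases i <;> simp [edgePoint, ht] <;> rfl

/-- The Moore loop of length `1` given by a pointed `1`-simplex. -/
def PSimplex.loop (σ : PSimplex X b 1) : MooreLoop X b :=
  ⟨(σ.1.comp ⟨edgePoint, continuous_edgePoint⟩, 1),
    (congrArg σ.1 edgePoint_zero).trans (σ.2 0),
    fun _ ht => (congrArg σ.1 (edgePoint_of_le ht)).trans (σ.2 1)⟩

/-- The path in the `2`-simplex which follows the edge from `0` to `1` on `[0, 1]` and, starting at
time `s`, moves towards the vertex `2`. For `s = 1` it runs through the vertex `1`, for `s = 0` it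
runs along the edge from `0` to `2`. -/
def trianglePoint (s : unitInterval) (t : ℝ≥0) : stdSimplex ℝ (Fin 3) :=
  ⟨![1 - min (t : ℝ) 1, min (t : ℝ) 1 - min (max (t - s : ℝ) 0) 1, min (max (t - s : ℝ) 0) 1], by
    constructor
    · intro i
      have h₁ : (t : ℝ) - s ≤ t := by linarith [s.2.1]
      have h₂ : max ((t : ℝ) - s) 0 ≤ t := max_le h₁ t.2
      have h₃ := min_le_min_right 1 h₂
      have h₄ : 0 ≤ min (max ((t : ℝ) - s) 0) 1 := le_min (le_max_right _ _) zero_le_one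
      fin_cases i
      · simp
      · exact sub_nonneg.2 h₃
      · exact h₄
    · simp [Fin.sum_univ_three]⟩

lemma continuous_trianglePoint :
    Continuous fun p : unitInterval × ℝ≥0 => trianglePoint p.1 p.2 := by
  refine Continuous.subtype_mk (continuous_pi fun i => ?_) _
  fin_cases i <;> simp <;> fun_prop

lemma trianglePoint_zero (s : unitInterval) : trianglePoint s 0 = stdSimplex.vertex 0 := by
  have : max (-(s : ℝ)) 0 = 0 := max_eq_right (by linarith [s.2.1])
  ext i
  fin_cases i <;> simp [trianglePoint, s.2.1] <;> rfl

lemma trianglePoint_of_le (s : unitInterval) {t : ℝ≥0} (ht : 1 + Real.toNNReal s ≤ t) :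
    trianglePoint s t = stdSimplex.vertex 2 := by
  have ht : (1 : ℝ) + s ≤ t := by
    have := NNReal.coe_le_coe.2 ht
    simpa [Real.coe_toNNReal _ s.2.1] using this
  have h₁ : min (t : ℝ) 1 = 1 := min_eq_right (by linarith [s.2.1])
  have h₂ : min (max ((t : ℝ) - s) 0) 1 = 1 := min_eq_right (le_max_of_le_left (by linarith))
  ext i
  fin_cases i <;> simp [trianglePoint, h₁, h₂] <;> rfl

lemma trianglePoint_zero_left (t : ℝ≥0) :
    trianglePoint 0 t = stdSimplex.map (Fin.succAbove 1) (edgePoint t) := by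
  ext i
  fin_cases i <;>
    simp [trianglePoint, edgePoint, FunOnFinite.linearMap_apply_apply, Finset.sum_filter,
      Fin.sum_univ_two] <;> rfl

lemma trianglePoint_one_left_of_le {t : ℝ≥0} (ht : t ≤ 1) :
    trianglePoint 1 t = stdSimplex.map (fun i : Fin 2 => (⟨i, by omega⟩ : Fin 3)) (edgePoint t) := by
  have h : (t : ℝ) ≤ 1 := ht
  ext i
  fin_cases i <;>
    simp [trianglePoint, edgePoint, FunOnFinite.linearMap_apply_apply, Finset.sum_filter,
      Fin.sum_univ_two, h] <;> rfl

lemma trianglePoint_one_left_of_ge {t : ℝ≥0} (ht : 1 ≤ t) :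
    trianglePoint 1 t =
      stdSimplex.map (fun i : Fin 2 => (⟨1 + i, by omega⟩ : Fin 3)) (edgePoint (t - 1)) := by
  have h : (1 : ℝ) ≤ t := ht
  have h' : ((t - 1 : ℝ≥0) : ℝ) = t - 1 := NNReal.coe_sub ht
  ext i
  fin_cases i <;>
    simp [trianglePoint, edgePoint, FunOnFinite.linearMap_apply_apply, Finset.sum_filter,
      Fin.sum_univ_two, h, h'] <;> rfl

/-- The family of Moore loops of length `1 + s` given by a pointed `2`-simplex. -/
def PSimplex.triangleLoop (σ : PSimplex X b 2) (s : unitInterval) : MooreLoop X b :=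
  ⟨(σ.1.comp ⟨trianglePoint s, continuous_trianglePoint.comp (Continuous.prodMk_right s)⟩,
    1 + Real.toNNReal s),
    (congrArg σ.1 (trianglePoint_zero s)).trans (σ.2 0),
    fun _ ht => (congrArg σ.1 (trianglePoint_of_le s ht)).trans (σ.2 2)⟩

lemma PSimplex.continuous_triangleLoop (σ : PSimplex X b 2) : Continuous σ.triangleLoop :=
  MooreLoop.continuous_mk _ (σ.1.continuous.comp continuous_trianglePoint) <| by
    change Continuous fun s : unitInterval => 1 + Real.toNNReal s
    fun_prop

lemma PSimplex.triangleLoop_zero (σ : PSimplex X b 2) : σ.triangleLoop 0 = (σ.face 1).loop := by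
  refine MooreLoop.ext (fun t => congrArg σ.1 (trianglePoint_zero_left t)) ?_
  change 1 + Real.toNNReal ((0 : unitInterval) : ℝ) = 1
  simp

lemma PSimplex.triangleLoop_one (σ : PSimplex X b 2) : σ.triangleLoop 1 =
    (σ.front (p := 1) (q := 1) rfl).loop * (σ.back (p := 1) (q := 1) rfl).loop := by
  refine MooreLoop.ext (fun t => ?_) ?_
  · rw [MooreLoop.mul_toMap]
    split_ifs with h
    · exact congrArg σ.1 (trianglePoint_one_left_of_le h)
    · exact congrArg σ.1 (trianglePoint_one_left_of_ge (not_le.1 h).le)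
  · change 1 + Real.toNNReal ((1 : unitInterval) : ℝ) = 1 + 1
    simp

lemma PSimplex.loop_of_isDegenerate {σ : PSimplex X b 1} (h : σ.IsDegenerate) (t : ℝ≥0) :
    σ.loop.toMap t = b := by
  obtain ⟨j, τ, rfl⟩ := h
  refine Eq.trans (congrArg τ.1 ?_) (τ.2 0)
  exact Subsingleton.elim _ _

/-- The constant loop of length `s`. -/
def constLoop (X : Type u) [TopologicalSpace X] (b : X) (s : unitInterval) : MooreLoop X b :=
  ⟨(ContinuousMap.const _ b, Real.toNNReal s), by simp⟩

lemma continuous_constLoop : Continuous (constLoop X b) :=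
  MooreLoop.continuous_mk _ continuous_const <| by
    change Continuous fun s : unitInterval => Real.toNNReal s
    fun_prop

/-- The algebra `C^□_*(Ω_b X; ℚ)` of normalized singular cubical chains on the Moore loops. -/
abbrev LoopChains (X : Type u) [TopologicalSpace X] (b : X) : Type u := CubeChains (MooreLoop X b)

/-- The zeroth homology algebra of the space of Moore loops. -/
abbrev H0Loops (X : Type u) [TopologicalSpace X] (b : X) : Type u :=
  H0 (cubeGr (MooreLoop X b)) (cubeD (MooreLoop X b))

lemma pointClass_face (σ : PSimplex X b 2) : pointClass (σ.face 1).loop =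
    pointClass (σ.front (p := 1) (q := 1) rfl).loop *
      pointClass (σ.back (p := 1) (q := 1) rfl).loop := by
  rw [← pointClass_mul, ← σ.triangleLoop_zero, ← σ.triangleLoop_one]
  exact pointClass_eq_of_path ⟨_, σ.continuous_triangleLoop⟩

lemma pointClass_of_isDegenerate {σ : PSimplex X b 1} (h : σ.IsDegenerate) :
    pointClass σ.loop = 1 := by
  have h₀ : constLoop X b 0 = 1 := MooreLoop.ext (fun _ => rfl) (by
    change Real.toNNReal ((0 : unitInterval) : ℝ) = 0
    simp)
  have h₁ : constLoop X b 1 = σ.loop :=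
    MooreLoop.ext (fun t => (PSimplex.loop_of_isDegenerate h t).symm) (by
      change Real.toNNReal ((1 : unitInterval) : ℝ) = 1
      simp)
  rw [← h₁, ← pointClass_one, ← h₀]
  exact (pointClass_eq_of_path ⟨_, continuous_constLoop⟩).symm

/-- Auxiliary: the map from the cobar construction which is zero in positive degrees and sends `[σ]`
to the class of the loop of `σ` minus `1`. -/
def cobarToLoops (X : Type u) [TopologicalSpace X] (b : X) : Cobar X b →ₐ[ℚ] H0Loops X b :=
  TA.lift fun n => match n with
    | 0 => NChain.lift (fun σ => pointClass σ.loop - 1) fun σ h => by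
        rw [pointClass_of_isDegenerate h, sub_self]
    | _ + 1 => 0

lemma cobarToLoops_edge (σ : PSimplex X b 1) :
    cobarToLoops X b (cubeGen σ) = pointClass σ.loop := by
  rw [cubeGen, map_add, map_one, cobarGen, cobarToLoops, TA.lift_gen, NChain.lift_of]
  abel

lemma cobarToLoops_gen {n : ℕ} (σ : PSimplex X b (n + 2)) :
    cobarToLoops X b (cobarGen σ) = 0 := by
  rw [cobarGen, cobarToLoops, TA.lift_gen]
  rfl

/-- The map `H₀(Ω C_*(X, b; ℚ)) → H₀(Ω_b X; ℚ)` induced by Adams' map `θ`: since `θ` sends the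
generator `[σ]` of a pointed `1`-simplex to the loop of `σ` minus the unit loop, up to a boundary,
`H₀(θ)` sends the class of `1 + [σ]` to the class of the loop of `σ`. -/
def H0theta (X : Type u) [TopologicalSpace X] (b : X) : H0Cobar X b →ₐ[ℚ] H0Loops X b :=
  H0.lift ((cobarToLoops X b).comp (cycles₀ (cobarGr X b) (cobarD X b)).val) <| by
    intro z c _ hc
    have := comp_cobarD_eq_zero (cobarToLoops X b) (fun n σ => cobarToLoops_gen σ)
      (fun σ => by rw [cobarToLoops_edge, cobarToLoops_edge, cobarToLoops_edge, pointClass_face]) c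
    rw [AlgHom.comp_apply, Subalgebra.coe_val, ← hc]
    exact this

lemma H0theta_edge (σ : PSimplex X b 1) : H0theta X b (edge σ) = pointClass σ.loop :=
  cobarToLoops_edge σ

/-- A morphism of differential graded algebras `θ : Ω C_*(X, b; ℚ) → C^□_*(Ω_b X; ℚ)` extends the
first step of Adams' construction if, up to boundaries, it sends the generator `[σ]` of a pointed
`1`-simplex to the loop of `σ` minus the unit loop. -/
structure IsAdamsMap (θ : Cobar X b →ₐ[ℚ] LoopChains X b) : Prop
    extends IsDGHom (cobarGr X b) (cobarD X b) (cubeGr (MooreLoop X b)) (cubeD (MooreLoop X b)) θ where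
  edge : ∀ σ : PSimplex X b 1, ∃ c ∈ cubeGr (MooreLoop X b) 1,
    cubeD (MooreLoop X b) c = θ (cobarGen σ) - (CubeChains.of (Cube.point σ.loop) - 1)

lemma Pi1.map_mk {Y : Type u} [TopologicalSpace Y] {c : Y} (f : C(X, Y)) (hf : f b = c)
    (p : Path b b) :
    Pi1.map f hf (Pi1.mk p) = Pi1.mk ((p.map f.continuous).cast hf.symm hf.symm) := by
  subst hf
  simp [Pi1.map, Pi1.mk, MonoidHom.op, FundamentalGroup.mapOfEq_apply]
  rfl

end Moore

end

end LoopCobar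

open LoopCobar

/-! The degree-zero homology of the cobar construction is a presentation of the group algebra of the
fundamental group. A pointed `1`-simplex is a loop at `b`. The algebra is generated by the classes
`edge σ` of `1 + [σ]`. A pointed `2`-simplex imposes `edge (σ.face 1) = edge front * edge back`, and
a degenerate `1`-simplex gives `1`. Filling triangles inside a concatenation or a homotopy shows
that these relations already force concatenation to become multiplication and homotopic loops to
have the same class (`edge_ofPath_trans`, `edge_ofPath_eq_of_homotopic`). Hence a loop class
determines an element of `H0Cobar X b`, which extends to the algebra map `piToH0Cobar`.

Three algebra maps form a directed triangle: `H0theta` from `H0Cobar` to `H0Loops`, `H0Loops.toPi1`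
from there to the group algebra, and `piToH0Cobar` back to the start. The middle map exists because
a `1`-cube of Moore loops is a homotopy of loops. All three round trips are identities. On `H0Cobar`
and on the group algebra this is an exact equality on generators, since loops and pointed
`1`-simplices correspond bijectively (`PSimplex.ofPath_loop_toPath`, `PSimplex.loop_toPath_ofPath`).
On `H0Loops` it holds only in homology: a Moore loop is joined to its version of length one by the
path `MooreLoop.rescale` in the space of Moore loops. So all three maps are isomorphisms.

The rest is transport along the composite isomorphism `H0Cobar.equivPi1`. Each `edge σ` is
group-like and goes to a group element, so the isomorphism respects coproduct and counit. The
antipode is that of the group algebra, and the group-like elements correspond to those of the group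
algebra over `ℚ`, which are the group elements. Naturality, and uniqueness of the map induced by a
dg morphism `θ`, are checked on the generators `edge σ`. -/

namespace LoopCobar

noncomputable section

/-! ### Relations between loops in the cobar construction -/

section PathSimplices

variable {X : Type u} [TopologicalSpace X] {b : X}

lemma vertex_apply {n : ℕ} (i j : Fin (n + 1)) :
    (stdSimplex.vertex (S := ℝ) i) j = if j = i then 1 else 0 := by
  simp [stdSimplex.vertex, Pi.single_apply]

lemma continuous_simplex_apply {n : ℕ} (i : Fin n) :
    Continuous fun x : stdSimplex ℝ (Fin n) => x i :=
  (continuous_apply i).comp continuous_subtype_val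

/-- The pointed `1`-simplex given by a loop. -/
def PSimplex.ofPath (p : Path b b) : PSimplex X b 1 :=
  -- The barycentric coordinate of the vertex `1` is the time; `extend` allows any real number as
  -- time, so no bounds on the coordinate have to be carried along.
  ⟨⟨fun x => p.extend (x 1), p.continuous_extend.comp (continuous_simplex_apply 1)⟩, fun i => by
    fin_cases i <;> simp [vertex_apply]⟩

/-- The pointed `2`-simplex given by a map on the plane. -/
def PSimplex.ofPlane (F : C(ℝ × ℝ, X)) (h₀ : F (0, 0) = b) (h₁ : F (1, 0) = b)
    (h₂ : F (0, 1) = b) : PSimplex X b 2 :=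
  -- The simplex is identified with the triangle with vertices `(0, 0)`, `(1, 0)`, `(0, 1)`, in this
  -- order.
  ⟨⟨fun x => F (x 1, x 2),
    F.continuous.comp ((continuous_simplex_apply 1).prodMk (continuous_simplex_apply 2))⟩, fun i => by
    fin_cases i <;> simp [vertex_apply, h₀, h₁, h₂]⟩

lemma simplex_one_eq (x : stdSimplex ℝ (Fin 2)) : x 0 = 1 - x 1 := by
  have := x.2.2
  rw [Fin.sum_univ_two] at this
  exact eq_sub_of_add_eq this

lemma simplex_one_mem (x : stdSimplex ℝ (Fin 2)) : x 1 ∈ Set.Icc (0 : ℝ) 1 :=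
  ⟨x.2.1 1, by
    have : 0 ≤ x 0 := x.2.1 0
    linarith [simplex_one_eq x]⟩

/-- A triangle whose three edges run along loops gives a relation between them. -/
lemma edge_ofPath_of_plane (p q r : Path b b) (F : C(ℝ × ℝ, X))
    (hp : ∀ t ∈ Set.Icc (0 : ℝ) 1, F (t, 0) = p.extend t)
    (hq : ∀ t ∈ Set.Icc (0 : ℝ) 1, F (1 - t, t) = q.extend t)
    (hr : ∀ t ∈ Set.Icc (0 : ℝ) 1, F (0, t) = r.extend t) :
    edge (PSimplex.ofPath r) = edge (PSimplex.ofPath p) * edge (PSimplex.ofPath q) := by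
  have h0 : (0 : ℝ) ∈ Set.Icc (0 : ℝ) 1 := by simp
  have h1 : (1 : ℝ) ∈ Set.Icc (0 : ℝ) 1 := by simp
  let σ := PSimplex.ofPlane F (by simpa using hp 0 h0) (by simpa using hp 1 h1)
    (by simpa using hr 1 h1)
  -- On the edge from `0` to `2` the first plane coordinate vanishes; on the edge from `0` to `1`
  -- the second one does; the edge from `1` to `2` is `t ↦ (1 - t, t)`.
  have e₁ : σ.face 1 = PSimplex.ofPath r := Subtype.ext <| ContinuousMap.ext fun x => by
    refine Eq.trans ?_ (hr _ (simplex_one_mem x))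
    refine congrArg F ?_
    simp [FunOnFinite.linearMap_apply_apply, Finset.sum_filter, Fin.sum_univ_two]
  have e₂ : σ.front (p := 1) (q := 1) rfl = PSimplex.ofPath p :=
    Subtype.ext <| ContinuousMap.ext fun x => by
    refine Eq.trans ?_ (hp _ (simplex_one_mem x))
    refine congrArg F ?_
    simp [FunOnFinite.linearMap_apply_apply, Finset.sum_filter, Fin.sum_univ_two]
  have e₃ : σ.back (p := 1) (q := 1) rfl = PSimplex.ofPath q :=
    Subtype.ext <| ContinuousMap.ext fun x => by
    refine Eq.trans ?_ (hq _ (simplex_one_mem x))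
    refine congrArg F ?_
    rw [← simplex_one_eq]
    simp [FunOnFinite.linearMap_apply_apply, Finset.sum_filter, Fin.sum_univ_two]
  rw [← e₁, ← e₂, ← e₃, edge_face]

/-- In normalized chains `[σ] = 0`, so only the summand `1` of `1 + [σ]` is left. -/
lemma edge_of_isDegenerate {σ : PSimplex X b 1} (h : σ.IsDegenerate) : edge σ = 1 := by
  rw [← cobarPi_cubeGen, cubeGen, cobarGen_eq_zero h, add_zero, map_one]

lemma edge_ofPath_refl : edge (PSimplex.ofPath (Path.refl b)) = 1 := by
  -- The constant loop is the degeneracy of the unique pointed `0`-simplex.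
  refine edge_of_isDegenerate ⟨0, ⟨ContinuousMap.const _ b, fun _ => rfl⟩, ?_⟩
  refine Subtype.ext <| ContinuousMap.ext fun x => ?_
  simp [PSimplex.ofPath, PSimplex.degen, PSimplex.pull]

/-- The time parameter `x / 2 + y` is affine on the triangle and takes the values `0`, `1/2`, `1` at
the vertices `0`, `1`, `2`. The short edges therefore run through the two halves of the
concatenation and the edge from `0` to `2` runs through all of it. -/
lemma edge_ofPath_trans (p q : Path b b) : edge (PSimplex.ofPath (p.trans q)) =
    edge (PSimplex.ofPath p) * edge (PSimplex.ofPath q) := by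
  refine edge_ofPath_of_plane p q _ ⟨fun x => (p.trans q).extend (x.1 / 2 + x.2), by fun_prop⟩ ?_ ?_
    fun t _ => by simp
  · intro t ht
    simp only [ContinuousMap.coe_mk]
    rw [Path.extend_apply _ (by constructor <;> linarith [ht.1, ht.2]), Path.trans_apply,
      dif_pos (by simp; linarith [ht.2]), Path.extend_apply _ ht]
    congr 2; simp; ring
  · intro t ht
    simp only [ContinuousMap.coe_mk]
    rw [Path.extend_apply _ (by constructor <;> linarith [ht.1, ht.2]), Path.trans_apply]
    split_ifs with h
    -- The time on this edge is `(1 + t) / 2`, and `Path.trans` assigns the midpoint to `p`; only `t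
    -- = 0` falls into that case, where both loops are at `b`.
    · have : t = 0 := by simp at h; linarith [ht.1]
      subst this
      simp
    · rw [Path.extend_apply _ ht]
      congr 2; simp; ring

/-- The square of the homotopy is cut along its diagonal `d`. The two triangles have sides `p`,
constant, `d` and constant, `q`, `d`, so the classes of `p` and of `q` both equal that of `d`. -/
lemma edge_ofPath_eq_of_homotopic {p q : Path b b} (h : p.Homotopic q) :
    edge (PSimplex.ofPath p) = edge (PSimplex.ofPath q) := by
  obtain ⟨H⟩ := h
  -- Clamping both coordinates extends the homotopy to the plane, as `PSimplex.ofPlane` requires;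
  -- the first coordinate is the homotopy parameter.
  let G : ℝ × ℝ → X := fun x =>
    H (Set.projIcc 0 1 zero_le_one x.1, Set.projIcc 0 1 zero_le_one x.2)
  have hG : Continuous G := by fun_prop
  let d : Path b b :=
    { toFun := fun t => H (t, t)
      continuous_toFun := by fun_prop
      source' := by simp
      target' := by simp }
  have hd : ∀ t, G (t, t) = d.extend t := fun t => rfl
  have hp : ∀ t, G (0, t) = p.extend t := fun t => by
    simp [G, Path.extend, Set.IccExtend]
  have hq : ∀ t, G (1, t) = q.extend t := fun t => by
    simp [G, Path.extend, Set.IccExtend]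
  have h0 : ∀ t, G (t, 0) = b := fun t => by simp [G]
  have h1 : ∀ t, G (t, 1) = b := fun t => by simp [G]
  -- The vertices of this triangle go to the corners `(0, 0)`, `(0, 1)`, `(1, 1)` of the square;
  -- those of the next one go to `(0, 0)`, `(1, 0)`, `(1, 1)`.
  have e₁ := edge_ofPath_of_plane p (Path.refl b) d ⟨fun x => G (x.2, x.1 + x.2), by fun_prop⟩
    (fun t _ => by simp [hp]) (fun t _ => by simp [h1]) (fun t _ => by simp [hd])
  have e₂ := edge_ofPath_of_plane (Path.refl b) q d ⟨fun x => G (x.1 + x.2, x.2), by fun_prop⟩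
    (fun t _ => by simp [h0]) (fun t _ => by simp [hq]) (fun t _ => by simp [hd])
  rw [edge_ofPath_refl, mul_one] at e₁
  rw [edge_ofPath_refl, one_mul] at e₂
  rw [← e₁, e₂]

lemma Pi1.mk_surjective : Function.Surjective (Pi1.mk : Path b b → Pi1 X b) := fun g => by
  obtain ⟨p, hp⟩ := Path.Homotopic.Quotient.mk_surjective (FundamentalGroup.toPath g.unop)
  exact ⟨p, congrArg (fun x => MulOpposite.op (FundamentalGroup.fromPath x)) hp⟩

lemma Pi1.mk_eq_of_homotopic {p q : Path b b} (h : p.Homotopic q) : Pi1.mk p = Pi1.mk q :=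
  congrArg (fun x => MulOpposite.op (FundamentalGroup.fromPath x)) (Quotient.sound h)

variable (X b) in
/-- The homomorphism from the fundamental group to `H₀(Ω C_*(X, b; ℚ))` sending the class of a loop
to the class of the corresponding `1`-simplex. -/
def Pi1.toH0Cobar : Pi1 X b →* H0Cobar X b where
  toFun g := Quotient.lift (fun p : Path b b => edge (PSimplex.ofPath p))
    (fun _ _ h => edge_ofPath_eq_of_homotopic h) (FundamentalGroup.toPath g.unop)
  map_one' := edge_ofPath_refl
  map_mul' g h := by
    -- On representatives the product of `Pi1` is, by definition, the class of `p.trans q`, which is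
    -- why the opposite of `FundamentalGroup` is the right group here.
    obtain ⟨p, rfl⟩ : ∃ p, Pi1.mk p = g := Pi1.mk_surjective g
    obtain ⟨q, rfl⟩ : ∃ p, Pi1.mk p = h := Pi1.mk_surjective h
    exact edge_ofPath_trans p q

lemma Pi1.toH0Cobar_mk (p : Path b b) :
    Pi1.toH0Cobar X b (Pi1.mk p) = edge (PSimplex.ofPath p) := rfl

end PathSimplices

/-! ### Moore loops compared with loops on the unit interval -/

section MoorePaths

variable {X : Type u} [TopologicalSpace X] {b : X}

/-- Evaluation on `C(ℝ≥0, X) × ℝ≥0` is jointly continuous because `ℝ≥0` is locally compact. This is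
what turns continuous families of Moore loops into homotopies. -/
lemma MooreLoop.continuous_eval {T : Type*} [TopologicalSpace T] {f : T → MooreLoop X b}
    {s : T → ℝ≥0} (hf : Continuous f) (hs : Continuous s) :
    Continuous fun t => (f t).toMap (s t) :=
  (MooreLoop.continuous_toMap.comp hf).eval hs

lemma MooreLoop.continuous_toPath {T : Type*} [TopologicalSpace T] {f : T → MooreLoop X b}
    {s : T → unitInterval} (hf : Continuous f) (hs : Continuous s) :
    Continuous fun t => (f t).toPath (s t) :=
  continuous_eval hf ((continuous_length.comp hf).mul
    (continuous_real_toNNReal.comp (continuous_subtype_val.comp hs)))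

/-- A path in the space of Moore loops is a homotopy of loops. -/
lemma Pi1.mk_toPath_eq_of_path (Γ : C(unitInterval, MooreLoop X b)) :
    Pi1.mk (Γ 0).toPath = Pi1.mk (Γ 1).toPath :=
  Pi1.mk_eq_of_homotopic ⟨
    { toFun := fun x => (Γ x.1).toPath x.2
      continuous_toFun :=
        MooreLoop.continuous_toPath (Γ.continuous.comp continuous_fst) continuous_snd
      map_zero_left := fun _ => rfl
      map_one_left := fun _ => rfl
      prop' := fun s t ht => by
        rcases ht with rfl | rfl <;> simp }⟩

/-- Two loops which run along a Moore loop with different speeds are homotopic. -/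
lemma MooreLoop.homotopic_of_reparam (γ : MooreLoop X b) (p q : Path b b)
    (φ ψ : C(unitInterval, ℝ≥0)) (hφ : φ 0 = 0) (hψ : ψ 0 = 0) (hφ' : γ.length ≤ φ 1)
    (hψ' : γ.length ≤ ψ 1) (hp : ∀ t, p t = γ.toMap (φ t)) (hq : ∀ t, q t = γ.toMap (ψ t)) :
    p.Homotopic q :=
  -- The two clocks `φ` and `ψ` are interpolated linearly. At the final time the interpolated clock
  -- still shows at least `γ.length`, after which `γ` rests at `b`, so it does not matter if the
  -- clocks overshoot.
  ⟨{toFun := fun x => γ.toMap (Real.toNNReal (1 - x.1) * φ x.2 + Real.toNNReal x.1 * ψ x.2)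
    continuous_toFun := by fun_prop
    map_zero_left := fun t => by simp [hp]
    map_one_left := fun t => by simp [hq]
    prop' := fun s t ht => by
      have hs : Real.toNNReal (1 - s) + Real.toNNReal s = 1 := by
        rw [← Real.toNNReal_add (sub_nonneg.2 s.2.2) s.2.1]; simp
      rcases ht with rfl | rfl
      · simp [hφ, hψ, toMap_zero]
      · simp only [ContinuousMap.coe_mk, Path.coe_toContinuousMap, Path.target]
        refine toMap_of_length_le _ ?_
        calc γ.length = (Real.toNNReal (1 - s) + Real.toNNReal s) * γ.length := by
              rw [hs, one_mul]
          _ ≤ _ := by rw [add_mul]; gcongr }⟩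

lemma MooreLoop.toPath_mul_homotopic (γ δ : MooreLoop X b) :
    (γ * δ).toPath.Homotopic (γ.toPath.trans δ.toPath) := by
  refine (γ * δ).homotopic_of_reparam _ _
    ⟨fun t => (γ * δ).length * Real.toNNReal t, by fun_prop⟩
    -- The clock of the concatenated path: it passes from `0` to `γ.length` in the first half and
    -- through the remaining `δ.length` in the second half.
    ⟨fun t => γ.length * min (Real.toNNReal (2 * t)) 1 + δ.length * Real.toNNReal (2 * t - 1),
      by fun_prop⟩ (by simp) (by simp) (by simp) (by norm_num [mul_length])
    (fun _ => rfl) fun t => ?_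
  rw [Path.trans_apply]
  split_ifs with h
  · have h₁ : Real.toNNReal (2 * t) ≤ 1 := Real.toNNReal_le_one.2 (by linarith)
    have h₂ : Real.toNNReal (2 * t - 1) = 0 := Real.toNNReal_of_nonpos (by linarith)
    simp only [ContinuousMap.coe_mk, h₂, mul_zero, add_zero, min_eq_left h₁, mul_toMap]
    rw [if_pos (mul_le_of_le_one_right' h₁)]
    rfl
  · have h' : (1 : ℝ) < 2 * t := by linarith [not_le.1 h]
    have h₁ : 1 ≤ Real.toNNReal (2 * t) := Real.one_le_toNNReal.2 h'.le
    simp only [ContinuousMap.coe_mk, min_eq_right h₁, mul_toMap, mul_one]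
    -- The clock now shows `γ.length + δ.length * (2 * t - 1)`. It falls into the first branch of
    -- the Moore product only if the second summand is zero, and then both sides are `b`.
    split_ifs with h₂
    · have h₃ : δ.length * Real.toNNReal (2 * t - 1) = 0 := by simpa using h₂
      change δ.toMap (δ.length * Real.toNNReal (2 * t - 1)) = _
      rw [h₃, toMap_zero, add_zero, toMap_of_length_le _ le_rfl]
    · rw [add_tsub_cancel_left]
      rfl

lemma Pi1.mk_toPath_mul (γ δ : MooreLoop X b) :
    Pi1.mk (γ * δ).toPath = Pi1.mk γ.toPath * Pi1.mk δ.toPath :=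
  Pi1.mk_eq_of_homotopic (γ.toPath_mul_homotopic δ)

lemma Pi1.mk_toPath_one : Pi1.mk (1 : MooreLoop X b).toPath = 1 :=
  congrArg Pi1.mk (Path.ext rfl : (1 : MooreLoop X b).toPath = Path.refl b)

/-- The Moore loop `γ` with its length rescaled to `1 - s + s * γ.length` by a linear change of
speed. -/
def MooreLoop.rescale (γ : MooreLoop X b) (s : unitInterval) : MooreLoop X b :=
  -- The speed factor is `1 - s + s * γ.length`, while the new length is `(1 - s) * γ.length + s`.
  -- No division by the length occurs, so loops of length `0` are covered.
  ⟨(γ.toMap.comp ⟨fun t => t * (Real.toNNReal (1 - s) + Real.toNNReal s * γ.length), by fun_prop⟩,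
    Real.toNNReal (1 - s) * γ.length + Real.toNNReal s), by simp [toMap_zero], fun t ht => by
    refine toMap_of_length_le _ (le_trans ?_ (mul_le_mul_left ht _))
    rw [← NNReal.coe_le_coe]
    simp only [NNReal.coe_mul, NNReal.coe_add, Real.coe_toNNReal _ s.2.1,
      Real.coe_toNNReal _ (sub_nonneg.2 s.2.2)]
    -- With `r = γ.length`, new length times speed minus `r` equals `s * (1 - s) * (r - 1) ^ 2`, so
    -- past the new length the argument of `γ` is at least `r`.
    nlinarith [mul_nonneg (mul_nonneg s.2.1 (sub_nonneg.2 s.2.2)) (sq_nonneg ((γ.length : ℝ) - 1))]⟩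

lemma MooreLoop.continuous_rescale (γ : MooreLoop X b) : Continuous γ.rescale := by
  refine continuous_mk _ ?_ ?_
  · change Continuous fun p : unitInterval × ℝ≥0 =>
      γ.toMap (p.2 * (Real.toNNReal (1 - p.1) + Real.toNNReal p.1 * γ.length))
    fun_prop
  · change Continuous fun s : unitInterval =>
      Real.toNNReal (1 - s) * γ.length + Real.toNNReal s
    fun_prop

lemma MooreLoop.rescale_zero (γ : MooreLoop X b) : γ.rescale 0 = γ :=
  ext (fun t => by
    change γ.toMap (t * (Real.toNNReal (1 - (0 : unitInterval)) +
      Real.toNNReal (0 : unitInterval) * γ.length)) = _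
    simp) (by
    change Real.toNNReal (1 - (0 : unitInterval)) * γ.length + Real.toNNReal (0 : unitInterval) = _
    simp)

lemma edgePoint_one (t : ℝ≥0) : edgePoint t 1 = min (t : ℝ) 1 := rfl

lemma MooreLoop.rescale_one (γ : MooreLoop X b) :
    γ.rescale 1 = (PSimplex.ofPath γ.toPath).loop :=
  ext (fun t => by
    change γ.toMap (t * (Real.toNNReal (1 - (1 : unitInterval)) +
      Real.toNNReal (1 : unitInterval) * γ.length)) = γ.toPath.extend (edgePoint t 1)
    rw [edgePoint_one, Path.extend_apply _ ⟨by simp, by simp⟩]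
    change _ = γ.toMap (γ.length * Real.toNNReal (min (t : ℝ) 1))
    rcases le_total t 1 with h | h
    · have h' : (t : ℝ) ≤ 1 := h
      simp [h', mul_comm]
    -- After time `1` the rescaled loop keeps advancing while the loop of the simplex is clamped;
    -- both have reached the end of `γ` and sit at `b`.
    · have h' : (1 : ℝ) ≤ t := h
      simp only [min_eq_right h', Real.toNNReal_one, mul_one]
      rw [toMap_of_length_le _ le_rfl, toMap_of_length_le]
      simpa using le_mul_of_one_le_left' h) (by
    change Real.toNNReal (1 - (1 : unitInterval)) * γ.length + Real.toNNReal (1 : unitInterval) = 1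
    simp)

/-- Passing to the unit interval forgets the length of `γ`. The family `γ.rescale` is a path of
Moore loops from `γ` to the loop of length one, hence a `1`-cube whose boundary is their difference.
-/
lemma pointClass_loop_ofPath (γ : MooreLoop X b) :
    pointClass (PSimplex.ofPath γ.toPath).loop = pointClass γ := by
  rw [← γ.rescale_one, eq_comm]
  nth_rewrite 1 [← γ.rescale_zero]
  exact pointClass_eq_of_path ⟨γ.rescale, γ.continuous_rescale⟩

lemma PSimplex.loop_toPath_apply (σ : PSimplex X b 1) (t : unitInterval) :
    σ.loop.toPath t = σ.1 (edgePoint (Real.toNNReal t)) := by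
  change σ.1 (edgePoint (1 * Real.toNNReal t)) = _
  rw [one_mul]

/-- An equality and not merely a homotopy: the loop of `σ` has length `1`, so `toPath` does not
change its speed, and a point of the `1`-simplex is determined by its coordinate at the vertex `1`.
-/
lemma PSimplex.ofPath_loop_toPath (σ : PSimplex X b 1) : ofPath σ.loop.toPath = σ :=
  Subtype.ext <| ContinuousMap.ext fun x => by
    change σ.loop.toPath.extend (x 1) = _
    have hx := simplex_one_mem x
    rw [Path.extend_apply _ hx, loop_toPath_apply]
    refine congrArg σ.1 (stdSimplex.ext ?_)
    have h : min ((Real.toNNReal (x 1) : ℝ≥0) : ℝ) 1 = x 1 := by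
      rw [Real.coe_toNNReal _ hx.1, min_eq_left hx.2]
    funext i
    fin_cases i
    · exact (congrArg (1 - ·) h).trans (simplex_one_eq x).symm
    · exact h

lemma PSimplex.loop_toPath_ofPath (p : Path b b) : (ofPath p).loop.toPath = p := by
  ext t
  rw [loop_toPath_apply]
  change p.extend (edgePoint _ 1) = _
  rw [edgePoint_one, Real.coe_toNNReal _ t.2.1, min_eq_left t.2.2, Path.extend_apply _ t.2]

end MoorePaths

/-! ### From cubical chains on Moore loops to the group algebra -/

section Kappa

variable {X : Type u} [TopologicalSpace X] {b : X}

/-- The map on cubes which sends a point of the space of Moore loops to its class in the fundamental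
group, and cubes of positive dimension to zero. -/
def cubeToPi1 (a : Cube (MooreLoop X b)) : MonoidAlgebra ℚ (Pi1 X b) :=
  if a.dim = 0 then MonoidAlgebra.single (Pi1.mk (a.ev 0).toPath) 1 else 0

/-- A degenerate cube has a coordinate on which it does not depend, so its dimension is positive. -/
lemma cubeToPi1_of_isDegenerate {a : Cube (MooreLoop X b)} (h : a.IsDegenerate) :
    cubeToPi1 a = 0 :=
  if_neg fun h0 => by
    obtain ⟨i, _⟩ := h
    exact (h0 ▸ i).elim0

/-- Dimensions add, so a product is a `0`-cube exactly when both factors are; in that case the claim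
is that concatenation of Moore loops induces the product of `Pi1`. -/
lemma cubeToPi1_mul (a c : Cube (MooreLoop X b)) :
    cubeToPi1 (a * c) = cubeToPi1 a * cubeToPi1 c := by
  unfold cubeToPi1
  rw [Cube.mul_dim]
  by_cases ha : a.dim = 0
  · by_cases hc : c.dim = 0
    · rw [if_pos (by omega), if_pos ha, if_pos hc, MonoidAlgebra.single_mul_single, mul_one,
        ← Pi1.mk_toPath_mul]
      rfl
    · rw [if_neg (by omega), if_neg hc, mul_zero]
  · rw [if_neg (by omega), if_neg ha, zero_mul]

variable (X b) in
/-- The algebra map from the cubical chains on the Moore loops to the group algebra of the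
fundamental group. -/
def loopChainsToPi1 : LoopChains X b →ₐ[ℚ] MonoidAlgebra ℚ (Pi1 X b) :=
  AlgHom.ofLinearMap
    (CubeChains.lift cubeToPi1 fun _ h => cubeToPi1_of_isDegenerate h)
    (by
      rw [← CubeChains.of_one, CubeChains.lift_of, cubeToPi1, if_pos Cube.one_dim,
        MonoidAlgebra.one_def]
      exact congrArg (MonoidAlgebra.single · 1) Pi1.mk_toPath_one)
    (fun x y => by
      induction x using CubeChains.induction with
      | h0 => simp
      | hadd x x' hx hx' => rw [add_mul, map_add, hx, hx', map_add, add_mul]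
      | hsmul r x hx => rw [smul_mul_assoc, map_smul, hx, map_smul, smul_mul_assoc]
      | hof a =>
        induction y using CubeChains.induction with
        | h0 => simp
        | hadd y y' hy hy' => rw [mul_add, map_add, hy, hy', map_add, mul_add]
        | hsmul r y hy => rw [mul_smul_comm, map_smul, hy, map_smul, mul_smul_comm]
        | hof c =>
          rw [← CubeChains.of_mul, CubeChains.lift_of, CubeChains.lift_of, CubeChains.lift_of,
            cubeToPi1_mul])

lemma loopChainsToPi1_of (a : Cube (MooreLoop X b)) :
    loopChainsToPi1 X b (CubeChains.of a) = cubeToPi1 a :=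
  CubeChains.lift_of _ (fun _ h => cubeToPi1_of_isDegenerate h) a

/-- A `1`-cube is a path of Moore loops, that is, a homotopy between its two ends. Their classes in
the fundamental group agree and cancel in the boundary. -/
lemma loopChainsToPi1_cubeD {c : LoopChains X b} (hc : c ∈ cubeGr (MooreLoop X b) 1) :
    loopChainsToPi1 X b (cubeD (MooreLoop X b) c) = 0 := by
  induction hc using Submodule.span_induction with
  | zero => simp
  | add x y hx hy ihx ihy => rw [map_add, map_add, ihx, ihy, add_zero]
  | smul r x hx ih => rw [map_smul, map_smul, ih, smul_zero]
  | mem x hx =>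
    obtain ⟨⟨n, f⟩, ha, rfl⟩ := hx
    obtain rfl : n = 1 := ha
    let a : Cube (MooreLoop X b) := ⟨1, f⟩
    -- The cube is defined on functions from `Fin 1`; constant functions turn it into a path on the
    -- unit interval.
    have key := Pi1.mk_toPath_eq_of_path (f.comp ⟨fun s _ => s, by fun_prop⟩)
    have hface : ∀ ε, (a.face 0 ε).ev 0 = f fun _ => ε := fun ε => by
      rw [Cube.face_ev ε a one_pos]
      refine congrArg f (funext fun k => ?_)
      simp [Cube.ins]
    have hd : cubeD (MooreLoop X b) (CubeChains.of a) =
        CubeChains.of (a.face 0 1) - CubeChains.of (a.face 0 0) := by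
      rw [cubeD_of]
      change ∑ i ∈ Finset.range 1, _ = _
      rw [Finset.sum_range_one, pow_zero, one_smul]
    have hdim : ∀ ε, (a.face 0 ε).dim = 0 := fun _ => rfl
    rw [hd, map_sub, loopChainsToPi1_of, loopChainsToPi1_of, cubeToPi1, cubeToPi1, if_pos (hdim _),
      if_pos (hdim _), hface, hface, sub_eq_zero]
    exact congrArg (MonoidAlgebra.single · 1) key.symm

variable (X b) in
/-- The algebra map from `H₀(Ω_b X; ℚ)` to the group algebra of the fundamental group. -/
def H0Loops.toPi1 : H0Loops X b →ₐ[ℚ] MonoidAlgebra ℚ (Pi1 X b) :=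
  H0.lift ((loopChainsToPi1 X b).comp (cycles₀ _ _).val) fun _ _ hc h =>
    (congrArg (loopChainsToPi1 X b) h.symm).trans (loopChainsToPi1_cubeD hc)

lemma H0Loops.toPi1_pointClass (γ : MooreLoop X b) :
    H0Loops.toPi1 X b (pointClass γ) = MonoidAlgebra.single (Pi1.mk γ.toPath) 1 :=
  loopChainsToPi1_of (Cube.point γ)

lemma Cube.eq_point {M : Type u} [TopologicalSpace M] (a : Cube M) (ha : a.dim = 0) :
    a = Cube.point (a.ev 0) :=
  Cube.ext_ev ha fun _ => Cube.ev_congr a fun k hk => by omega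

/-- The classes of points span `H₀` of the cubical chains. -/
lemma span_pointClass {M : Type u} [TopologicalSpace M] [Monoid M] [ContinuousMul M] :
    Submodule.span ℚ (Set.range (pointClass : M → H0 (cubeGr M) (cubeD M))) = ⊤ := by
  rw [eq_top_iff]
  rintro x -
  obtain ⟨⟨z, hz, hz'⟩, rfl⟩ := H0.mk_surjective _ _ x
  -- In degree zero being a cycle is automatic. Replacing the given proof by the one inside `cycle`
  -- makes the goal depend on `hz` alone, so that induction on the span is possible.
  suffices h : H0.mk (cubeGr M) (cubeD M) (cycle _ _ z hz) ∈
    Submodule.span ℚ (Set.range (pointClass : M → H0 (cubeGr M) (cubeD M))) from h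
  clear hz'
  induction hz using Submodule.span_induction with
  | zero => exact zero_mem _
  | add x y hx hy ihx ihy => exact add_mem ihx ihy
  | smul r x hx ih => exact Submodule.smul_mem _ r ih
  | mem x hx =>
    obtain ⟨a, ha, rfl⟩ := hx
    refine Submodule.subset_span ⟨a.ev 0, ?_⟩
    exact congrArg (H0.mk (cubeGr M) (cubeD M))
      (Subtype.ext (congrArg CubeChains.of (a.eq_point ha).symm))

end Kappa

/-! ### The triangle of isomorphisms -/

section Comparison

variable {X : Type u} [TopologicalSpace X] {b : X}

variable (X b) in
/-- The algebra map from the group algebra of the fundamental group to `H₀(Ω C_*(X, b; ℚ))`. -/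
def piToH0Cobar : MonoidAlgebra ℚ (Pi1 X b) →ₐ[ℚ] H0Cobar X b :=
  MonoidAlgebra.lift ℚ _ _ (Pi1.toH0Cobar X b)

lemma piToH0Cobar_single (g : Pi1 X b) :
    piToH0Cobar X b (MonoidAlgebra.single g 1) = Pi1.toH0Cobar X b g := by
  simp [piToH0Cobar]

variable (X b) in
/-- The composite of `H₀(θ)` with the map from `H₀(Ω_b X; ℚ)` to the group algebra. -/
def H0Cobar.toPi1 : H0Cobar X b →ₐ[ℚ] MonoidAlgebra ℚ (Pi1 X b) :=
  (H0Loops.toPi1 X b).comp (H0theta X b)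

lemma H0Cobar.toPi1_edge (σ : PSimplex X b 1) :
    H0Cobar.toPi1 X b (edge σ) = MonoidAlgebra.single (Pi1.mk σ.loop.toPath) 1 := by
  rw [toPi1, AlgHom.comp_apply, H0theta_edge, H0Loops.toPi1_pointClass]

/-- The elements `edge σ` generate the algebra, and on them the composite goes from `σ` to its loop
and back to the simplex of that loop, which is `σ` itself. -/
lemma piToH0Cobar_comp_toPi1 :
    (piToH0Cobar X b).comp (H0Cobar.toPi1 X b) = AlgHom.id ℚ _ :=
  H0Cobar.hom_ext fun σ => by
    rw [AlgHom.comp_apply, H0Cobar.toPi1_edge, piToH0Cobar_single, Pi1.toH0Cobar_mk,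
      PSimplex.ofPath_loop_toPath, AlgHom.id_apply]

lemma toPi1_comp_piToH0Cobar :
    (H0Cobar.toPi1 X b).comp (piToH0Cobar X b) = AlgHom.id ℚ _ :=
  MonoidAlgebra.algHom_ext (fun g => by
    change H0Cobar.toPi1 X b (piToH0Cobar X b (MonoidAlgebra.single g 1)) =
      MonoidAlgebra.single g 1
    obtain ⟨p, rfl⟩ := Pi1.mk_surjective g
    rw [piToH0Cobar_single, Pi1.toH0Cobar_mk, H0Cobar.toPi1_edge, PSimplex.loop_toPath_ofPath])
    (Subsingleton.elim _ _)

/-- By linearity the classes of points suffice. There the round trip replaces a Moore loop by its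
version of length one, which is homologous to it. -/
lemma H0theta_piToH0Cobar_toPi1 (x : H0Loops X b) :
    H0theta X b (piToH0Cobar X b (H0Loops.toPi1 X b x)) = x := by
  have h : ((H0theta X b).comp ((piToH0Cobar X b).comp (H0Loops.toPi1 X b))).toLinearMap =
      LinearMap.id := LinearMap.ext_on_range span_pointClass fun γ => by
    change H0theta X b (piToH0Cobar X b (H0Loops.toPi1 X b (pointClass γ))) = pointClass γ
    rw [H0Loops.toPi1_pointClass, piToH0Cobar_single, Pi1.toH0Cobar_mk, H0theta_edge,
      pointClass_loop_ofPath]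
  exact LinearMap.congr_fun h x

variable (X b) in
/-- The isomorphism `H₀(Ω_b X; ℚ) ≅ ℚ[π₁(X, b)]`. -/
def H0Loops.equivPi1 : H0Loops X b ≃ₐ[ℚ] MonoidAlgebra ℚ (Pi1 X b) :=
  AlgEquiv.ofAlgHom (H0Loops.toPi1 X b) ((H0theta X b).comp (piToH0Cobar X b))
    -- `H0Cobar.toPi1` is by definition `H0Loops.toPi1` after `H0theta`, so the first identity is
    -- the required one up to bracketing.
    toPi1_comp_piToH0Cobar (AlgHom.ext H0theta_piToH0Cobar_toPi1)

/-- The other two sides of the triangle compose to a two-sided inverse. -/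
lemma H0theta_bijective : Function.Bijective (H0theta X b) := by
  refine ⟨fun x y h => ?_, fun x => ⟨_, H0theta_piToH0Cobar_toPi1 x⟩⟩
  have := congrArg (fun z => piToH0Cobar X b (H0Loops.toPi1 X b z)) h
  exact ((AlgHom.congr_fun piToH0Cobar_comp_toPi1 x).symm.trans this).trans
    (AlgHom.congr_fun piToH0Cobar_comp_toPi1 y)

/-! ### Compatibility with the coalgebra structures -/

lemma comul_edge (σ : PSimplex X b 1) :
    Coalgebra.comul (R := ℚ) (edge σ) = edge σ ⊗ₜ[ℚ] edge σ :=
  H0Cobar.comul_edge σ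

lemma counit_edge (σ : PSimplex X b 1) : Coalgebra.counit (R := ℚ) (edge σ) = 1 :=
  H0Cobar.counit_edge σ

variable (X b) in
/-- The isomorphism of bialgebras `H₀(Ω C_*(X, b; ℚ)) ≅ ℚ[π₁(X, b)]`. -/
def H0Cobar.equivPi1 : H0Cobar X b ≃ₐc[ℚ] MonoidAlgebra ℚ (Pi1 X b) :=
  BialgEquiv.ofAlgEquiv
    (AlgEquiv.ofAlgHom (H0Cobar.toPi1 X b) (piToH0Cobar X b) toPi1_comp_piToH0Cobar
      piToH0Cobar_comp_toPi1)
    -- Counit and coproduct are algebra maps on both sides, so generators suffice: the group-like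
    -- `edge σ` goes to a group element, which is group-like too.
    (H0Cobar.hom_ext fun σ => by
      change Coalgebra.counit (R := ℚ) (H0Cobar.toPi1 X b (edge σ)) =
        Coalgebra.counit (R := ℚ) (edge σ)
      rw [toPi1_edge, LoopCobar.counit_edge]
      simp)
    (H0Cobar.hom_ext fun σ => by
      change TensorProduct.map (H0Cobar.toPi1 X b).toLinearMap (H0Cobar.toPi1 X b).toLinearMap
        (Coalgebra.comul (R := ℚ) (edge σ)) =
        Coalgebra.comul (R := ℚ) (H0Cobar.toPi1 X b (edge σ))
      rw [LoopCobar.comul_edge, TensorProduct.map_tmul, AlgHom.toLinearMap_apply, toPi1_edge]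
      simp)

lemma H0Cobar.equivPi1_apply (x : H0Cobar X b) :
    H0Cobar.equivPi1 X b x = H0Loops.equivPi1 X b (H0theta X b x) := rfl

lemma H0Cobar.equivPi1_toH0Cobar (g : Pi1 X b) :
    H0Cobar.equivPi1 X b (Pi1.toH0Cobar X b g) = MonoidAlgebra.single g 1 := by
  rw [← piToH0Cobar_single]
  exact AlgHom.congr_fun toPi1_comp_piToH0Cobar _

/-- The classes of loops span linearly, since `piToH0Cobar` is surjective and group elements form a
basis of the group algebra. This serves for maps not known to be multiplicative, as in the antipode
axioms. -/
lemma H0Cobar.linearMap_ext {W : Type*} [AddCommMonoid W] [Module ℚ W] {f g : H0Cobar X b →ₗ[ℚ] W}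
    (h : ∀ γ, f (Pi1.toH0Cobar X b γ) = g (Pi1.toH0Cobar X b γ)) : f = g := by
  have : f ∘ₗ (piToH0Cobar X b).toLinearMap = g ∘ₗ (piToH0Cobar X b).toLinearMap :=
    MonoidAlgebra.lhom_ext' fun γ => LinearMap.ext_ring <| by
      change f (piToH0Cobar X b (MonoidAlgebra.single γ 1)) =
        g (piToH0Cobar X b (MonoidAlgebra.single γ 1))
      rw [piToH0Cobar_single, h]
  ext x
  have hx := AlgHom.congr_fun (piToH0Cobar_comp_toPi1 (X := X) (b := b)) x
  rw [AlgHom.comp_apply, AlgHom.id_apply] at hx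
  rw [← hx]
  exact LinearMap.congr_fun this _

/-! ### Antipode and group-like elements -/

lemma isGroupLikeElem_toH0Cobar (g : Pi1 X b) : IsGroupLikeElem ℚ (Pi1.toH0Cobar X b g) := by
  obtain ⟨p, rfl⟩ := Pi1.mk_surjective g
  exact ⟨counit_edge _, comul_edge _⟩

variable (X b) in
/-- The antipode of `H₀(Ω C_*(X, b; ℚ))`. -/
def H0Cobar.antipode : H0Cobar X b →ₗ[ℚ] H0Cobar X b :=
  (piToH0Cobar X b).toLinearMap ∘ₗ
    HopfAlgebraStruct.antipode (A := MonoidAlgebra ℚ (Pi1 X b)) ℚ ∘ₗ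
      (H0Cobar.toPi1 X b).toLinearMap

lemma H0Cobar.antipode_toH0Cobar (g : Pi1 X b) :
    H0Cobar.antipode X b (Pi1.toH0Cobar X b g) = Pi1.toH0Cobar X b g⁻¹ := by
  have : H0Cobar.toPi1 X b (Pi1.toH0Cobar X b g) = MonoidAlgebra.single g 1 :=
    H0Cobar.equivPi1_toH0Cobar g
  simp [antipode, this, piToH0Cobar_single]

variable (X b) in
/-- The Hopf algebra structure on the bialgebra `H₀(Ω C_*(X, b; ℚ))`. -/
abbrev H0Cobar.hopfAlgebra : HopfAlgebra ℚ (H0Cobar X b) where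
  antipode := H0Cobar.antipode X b
  -- On the class of `g`, which is group-like with antipode the class of `g⁻¹`, the axiom reads `g⁻¹
  -- * g = 1`.
  mul_antipode_rTensor_comul := H0Cobar.linearMap_ext fun g => by
    simp only [LinearMap.comp_apply, (isGroupLikeElem_toH0Cobar g).comul_eq_tmul_self,
      (isGroupLikeElem_toH0Cobar g).counit_eq_one, LinearMap.rTensor_tmul, LinearMap.mul'_apply,
      antipode_toH0Cobar, ← map_mul, inv_mul_cancel, map_one, Algebra.linearMap_apply]
  mul_antipode_lTensor_comul := H0Cobar.linearMap_ext fun g => by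
    simp only [LinearMap.comp_apply, (isGroupLikeElem_toH0Cobar g).comul_eq_tmul_self,
      (isGroupLikeElem_toH0Cobar g).counit_eq_one, LinearMap.lTensor_tmul, LinearMap.mul'_apply,
      antipode_toH0Cobar, ← map_mul, mul_inv_cancel, map_one, Algebra.linearMap_apply]

variable (X b) in
/-- The map from the fundamental group to the group-like elements of `H₀(Ω C_*(X, b; ℚ))`. -/
def Pi1.toGroupLike : Pi1 X b →* GroupLike ℚ (H0Cobar X b) where
  toFun g := ⟨Pi1.toH0Cobar X b g, isGroupLikeElem_toH0Cobar g⟩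
  map_one' := GroupLike.val_injective (map_one (Pi1.toH0Cobar X b))
  map_mul' g h := GroupLike.val_injective (map_mul (Pi1.toH0Cobar X b) g h)

/-- Both halves are read off in the group algebra through `H0Cobar.equivPi1`: distinct group
elements are distinct basis vectors, and the group-like elements over `ℚ` are exactly the group
elements. -/
lemma Pi1.toGroupLike_bijective : Function.Bijective (Pi1.toGroupLike X b) := by
  constructor
  · intro g h hgh
    have : Pi1.toH0Cobar X b g = Pi1.toH0Cobar X b h := congrArg GroupLike.val hgh
    have := congrArg (H0Cobar.equivPi1 X b) this
    rw [H0Cobar.equivPi1_toH0Cobar, H0Cobar.equivPi1_toH0Cobar] at this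
    exact MonoidAlgebra.of_injective this
  · rintro ⟨x, hx⟩
    obtain ⟨g, hg⟩ := MonoidAlgebra.isGroupLikeElem_iff_mem_range_of.1
      (hx.map (H0Cobar.equivPi1 X b))
    refine ⟨g, GroupLike.val_injective ((H0Cobar.equivPi1 X b).injective ?_)⟩
    exact (H0Cobar.equivPi1_toH0Cobar g).trans hg

variable (X b) in
/-- The isomorphism from the fundamental group to the group-like elements of
`H₀(Ω C_*(X, b; ℚ))`. -/
def Pi1.equivGroupLike : Pi1 X b ≃* GroupLike ℚ (H0Cobar X b) :=
  MulEquiv.ofBijective (Pi1.toGroupLike X b) Pi1.toGroupLike_bijective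

lemma Pi1.equivGroupLike_val (g : Pi1 X b) :
    (Pi1.equivGroupLike X b g).val = Pi1.toH0Cobar X b g := rfl

/-- An algebra map on `H0Cobar X b` is determined by the elements `edge σ`, and these involve only
the values of `θ` on `1`-simplices, which are prescribed up to boundaries. -/
lemma IsAdamsMap.H0map_eq {θ : Cobar X b →ₐ[ℚ] LoopChains X b} (hθ : IsAdamsMap θ) :
    hθ.toIsDGHom.H0map = H0theta X b :=
  H0Cobar.hom_ext fun σ => by
    rw [H0theta_edge, ← sub_eq_zero, LoopCobar.edge, pointClass]
    change H0.mk _ _ _ - H0.mk _ _ _ = 0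
    rw [← map_sub, H0.mk_eq_zero]
    obtain ⟨c, hc, h⟩ := hθ.edge σ
    -- The chain bounding `θ [σ] - (γ_σ - 1)` also bounds `θ (1 + [σ]) - γ_σ`, because `θ` preserves
    -- `1`.
    refine ⟨c, hc, h.trans ?_⟩
    change _ = θ (cubeGen σ) - CubeChains.of (Cube.point σ.loop)
    rw [cubeGen, map_add, map_one]
    abel

end Comparison

/-! ### Naturality in the pointed space -/

section Functoriality

variable {X Y Z : Type u} [TopologicalSpace X] [TopologicalSpace Y] [TopologicalSpace Z]
  {b : X} {c : Y} {d : Z}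

lemma H0Cobar.map_edge (f : C(X, Y)) (hf : f b = c) (σ : PSimplex X b 1) :
    H0Cobar.map f hf (edge σ) = edge (σ.map f hf) :=
  H0map_edge f hf σ

/-- Composing a loop with `f` commutes definitionally with viewing it as a `1`-simplex. Naturality
of the isomorphism onto group-like elements and of `H0Cobar.equivPi1` both follow from this. -/
lemma H0Cobar.map_toH0Cobar (f : C(X, Y)) (hf : f b = c) (g : Pi1 X b) :
    H0Cobar.map f hf (Pi1.toH0Cobar X b g) = Pi1.toH0Cobar Y c (Pi1.map f hf g) := by
  obtain ⟨p, rfl⟩ := Pi1.mk_surjective g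
  rw [Pi1.map_mk, Pi1.toH0Cobar_mk, Pi1.toH0Cobar_mk, map_edge]
  rfl

lemma H0Cobar.equivPi1_map (f : C(X, Y)) (hf : f b = c) (x : H0Cobar X b) :
    H0Cobar.equivPi1 Y c (H0Cobar.map f hf x) =
      MonoidAlgebra.mapDomainBialgHom ℚ (Pi1.map f hf) (H0Cobar.equivPi1 X b x) := by
  have : (H0Cobar.toPi1 Y c).toLinearMap ∘ₗ ((H0Cobar.map f hf : H0Cobar X b →ₐ[ℚ] _)).toLinearMap =
      ((MonoidAlgebra.mapDomainBialgHom ℚ (Pi1.map f hf) : _ →ₐ[ℚ] _)).toLinearMap ∘ₗ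
        (H0Cobar.toPi1 X b).toLinearMap := H0Cobar.linearMap_ext fun g => by
    change H0Cobar.equivPi1 Y c (H0Cobar.map f hf (Pi1.toH0Cobar X b g)) =
      MonoidAlgebra.mapDomainBialgHom ℚ (Pi1.map f hf)
        (H0Cobar.equivPi1 X b (Pi1.toH0Cobar X b g))
    rw [map_toH0Cobar, equivPi1_toH0Cobar, equivPi1_toH0Cobar,
      MonoidAlgebra.mapDomainBialgHom_single]
  exact LinearMap.congr_fun this x

/-- A bialgebra map is determined by its underlying algebra map. The functor laws thus reduce to
`1`-simplices, where they express that composition of continuous maps is unital and associative. -/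
lemma H0Cobar.bialgHom_ext {W : Type*} [Ring W] [Bialgebra ℚ W] {f g : H0Cobar X b →ₐc[ℚ] W}
    (h : ∀ σ : PSimplex X b 1, f (edge σ) = g (edge σ)) : f = g :=
  BialgHom.ext fun x => AlgHom.congr_fun
    (H0Cobar.hom_ext (f := (f : H0Cobar X b →ₐ[ℚ] W)) (g := (g : H0Cobar X b →ₐ[ℚ] W)) h) x

lemma H0Cobar.map_id :
    H0Cobar.map (ContinuousMap.id X) (rfl : ContinuousMap.id X b = b) =
      BialgHom.id ℚ (H0Cobar X b) :=
  H0Cobar.bialgHom_ext fun σ => H0Cobar.map_edge (ContinuousMap.id X) rfl σ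

lemma H0Cobar.map_comp (f : C(X, Y)) (hf : f b = c) (g : C(Y, Z)) (hg : g c = d) :
    H0Cobar.map (g.comp f) ((congrArg g hf).trans hg) =
      (H0Cobar.map g hg).comp (H0Cobar.map f hf) :=
  H0Cobar.bialgHom_ext fun σ => by
    rw [BialgHom.comp_apply, map_edge, map_edge, map_edge]
    rfl

end Functoriality

end

end LoopCobar

theorem mainTheorem3 :
    ∃ (κ : ∀ (X : Type u) [TopologicalSpace X] [PathConnectedSpace X] (b : X),
          H0Loops X b ≃ₐ[ℚ] MonoidAlgebra ℚ (Pi1 X b))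
      (Φ : ∀ (X : Type u) [TopologicalSpace X] [PathConnectedSpace X] (b : X),
          H0Cobar X b ≃ₐc[ℚ] MonoidAlgebra ℚ (Pi1 X b))
      (e : ∀ (X : Type u) [TopologicalSpace X] [PathConnectedSpace X] (b : X),
          Pi1 X b ≃* GroupLike ℚ (H0Cobar X b)),
      (∀ (X : Type u) [TopologicalSpace X] [PathConnectedSpace X] (b : X),
        (∀ γ : MooreLoop X b,
          κ X b (pointClass γ) = MonoidAlgebra.single (Pi1.mk γ.toPath) 1) ∧
        (∀ x : H0Cobar X b, Φ X b x = κ X b (H0theta X b x)) ∧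
        Function.Bijective (H0theta X b) ∧
        (∀ (θ : Cobar X b →ₐ[ℚ] LoopChains X b) (hθ : IsAdamsMap θ),
          hθ.toIsDGHom.H0map = H0theta X b) ∧
        (∃ h : HopfAlgebra ℚ (H0Cobar X b),
          h.toBialgebra = (inferInstance : Bialgebra ℚ (H0Cobar X b))) ∧
        (∀ g : Pi1 X b, Φ X b (e X b g).val = MonoidAlgebra.single g 1)) ∧
      (∀ (X Y : Type u) [TopologicalSpace X] [PathConnectedSpace X] [TopologicalSpace Y]
          [PathConnectedSpace Y] (b : X) (c : Y) (f : C(X, Y)) (hf : f b = c),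
        (∀ x : H0Cobar X b, Φ Y c (H0Cobar.map f hf x) =
          MonoidAlgebra.mapDomainBialgHom ℚ (Pi1.map f hf) (Φ X b x)) ∧
        (∀ g : Pi1 X b, (e Y c (Pi1.map f hf g)).val = H0Cobar.map f hf (e X b g).val)) ∧
      (∀ (X : Type u) [TopologicalSpace X] [PathConnectedSpace X] (b : X),
        H0Cobar.map (ContinuousMap.id X) (rfl : ContinuousMap.id X b = b) =
          BialgHom.id ℚ (H0Cobar X b)) ∧
      (∀ (X Y Z : Type u) [TopologicalSpace X] [PathConnectedSpace X] [TopologicalSpace Y]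
          [PathConnectedSpace Y] [TopologicalSpace Z] [PathConnectedSpace Z]
          (b : X) (c : Y) (d : Z) (f : C(X, Y)) (hf : f b = c) (g : C(Y, Z)) (hg : g c = d),
        H0Cobar.map (g.comp f) ((congrArg g hf).trans hg) =
          (H0Cobar.map g hg).comp (H0Cobar.map f hf)) := by
  refine ⟨fun X _ _ b => H0Loops.equivPi1 X b, fun X _ _ b => H0Cobar.equivPi1 X b,
    fun X _ _ b => Pi1.equivGroupLike X b, fun X _ _ b => ⟨H0Loops.toPi1_pointClass,
      H0Cobar.equivPi1_apply, H0theta_bijective, fun _ hθ => hθ.H0map_eq,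
      -- The Hopf structure only adds an antipode to the existing bialgebra instance, so the two
      -- bialgebra structures agree by definition.
      ⟨H0Cobar.hopfAlgebra X b, rfl⟩,
      fun g => (congrArg _ (Pi1.equivGroupLike_val g)).trans (H0Cobar.equivPi1_toH0Cobar g)⟩,
    fun X Y _ _ _ _ b c f hf => ⟨H0Cobar.equivPi1_map f hf,
      fun g => by
        simp only [Pi1.equivGroupLike_val, H0Cobar.map_toH0Cobar]⟩,
    fun X _ _ b => H0Cobar.map_id,
    fun X Y Z _ _ _ _ _ _ b c d f hf g hg => H0Cobar.map_comp f hf g hg⟩
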